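/- Let $n\ge 2$ be an integer, let $r\in(0,+\infty)$, and let $q\in\mathbb{C}$ with $|q|=1$. For $k=(k_1,\dots,k_n)\in\mathbb{Z}_{\ge 0}^n$ put $|k|=k_1+\dots+k_n$, $k!=k_1!\cdots k_n!$, and consider formal power series $f=\sum_{k\in\mathbb{Z}_{\ge 0}^n}c_kx^k$ with $c_k\in\mathbb{C}$ and $x^k=x_1^{k_1}\cdots x_n^{k_n}$, multiplied according to the relations $x_ix_j=q\,x_jx_i$ for $i<j$, that is, $x^kx^\ell=q^{-\sum_{i>j}k_i\ell_j}\,x^{k+\ell}$. Let $$\mathcal{O}_q(\mathbb{D}^n_r)=\Bigl\{f=\sum_k c_kx^k:\ \|f\|_{\mathbb{D},\rho}=\sum_k|c_k|\,\rho^{|k|}<\infty\ \text{ for all }\rho\in(0,r)\Bigr\}$$ be the algebra of holomorphic functions on the quantum polydisk, and let $$\mathcal{O}_q(\mathbb{B}^n_r)=\Bigl\{f=\sum_k c_kx^k:\ \|f\|_{\mathbb{B},\rho}=\sum_k|c_k|\Bigl(\frac{k!}{|k|!}\Bigr)^{1/2}\rho^{|k|}<\infty\ \text{ for all }\rho\in(0,r)\Bigr\}$$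 be the algebra of holomorphic functions on the quantum ball. With the above multiplication and the topologies given by the norms $\|\cdot\|_{\mathbb{D},\rho}$ and $\|\cdot\|_{\mathbb{B},\rho}$ ($0<\rho<r$), respectively, both are Fréchet algebras over $\mathbb{C}$. Then $\mathcal{O}_q(\mathbb{D}^n_r)$ and $\mathcal{O}_q(\mathbb{B}^n_r)$ are not topologically isomorphic: there is no isomorphism of unital $\mathbb{C}$-algebras $\mathcal{O}_q(\mathbb{D}^n_r)\to\mathcal{O}_q(\mathbb{B}^n_r)$ that is a homeomorphism. -/

import Mathlib

noncomputable section

namespace QuantumHolomorphic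

/-- `∑_{i < j} k_i l_j`. -/
def cross {n : ℕ} (k l : Fin n → ℕ) : ℕ :=
  ∑ i, ∑ j, if i < j then k i * l j else 0

/-- The `t`-number `[m]_t = 1 + t + ⋯ + t^(m-1)`. -/
def qNumber (t : ℝ) (m : ℕ) : ℝ :=
  ∑ j ∈ Finset.range m, t ^ j

/-- The `t`-factorial `[m]_t! = [1]_t [2]_t ⋯ [m]_t`. -/
def qFactorial (t : ℝ) (m : ℕ) : ℝ :=
  ∏ j ∈ Finset.range m, qNumber t (j + 1)

/-- `[k]_t! = [k_1]_t! ⋯ [k_n]_t!` for a multi-index `k`. -/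
def qMultiFactorial (t : ℝ) {n : ℕ} (k : Fin n → ℕ) : ℝ :=
  ∏ i, qFactorial t (k i)

theorem cross_add_left {n : ℕ} (k k' l : Fin n → ℕ) :
    cross (k + k') l = cross k l + cross k' l := by
  simp only [cross, ← Finset.sum_add_distrib, Pi.add_apply]
  refine Finset.sum_congr rfl fun i _ => Finset.sum_congr rfl fun j _ => ?_
  split_ifs <;> ring

theorem cross_add_right {n : ℕ} (k l l' : Fin n → ℕ) :
    cross k (l + l') = cross k l + cross k l' := by
  simp only [cross, ← Finset.sum_add_distrib, Pi.add_apply]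
  refine Finset.sum_congr rfl fun i _ => Finset.sum_congr rfl fun j _ => ?_
  split_ifs <;> ring

theorem cross_zero_left {n : ℕ} (l : Fin n → ℕ) : cross 0 l = 0 := by simp [cross]

theorem cross_zero_right {n : ℕ} (k : Fin n → ℕ) : cross k 0 = 0 := by simp [cross]

theorem cross_castSucc {n : ℕ} (k l : Fin (n + 1) → ℕ) :
    cross k l = cross (fun i => k i.castSucc) (fun i => l i.castSucc)
      + (∑ i : Fin n, k i.castSucc) * l (Fin.last n) := by
  simp only [cross, Fin.sum_univ_castSucc, Fin.castSucc_lt_castSucc_iff, Fin.castSucc_lt_last,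
    if_true, lt_irrefl, if_false, Finset.sum_add_distrib, Finset.sum_mul]
  have h : ∀ i : Fin n, ¬ Fin.last n < i.castSucc := fun i => not_lt.2 (Fin.le_last _)
  simp [h]

theorem qNumber_succ_pos {t : ℝ} (ht : 0 < t) (m : ℕ) : 0 < qNumber t (m + 1) :=
  Finset.sum_pos (fun _ _ => pow_pos ht _) ⟨0, by simp⟩

theorem qNumber_add (t : ℝ) (a b : ℕ) :
    qNumber t (a + b) = qNumber t a + t ^ a * qNumber t b := by
  simp [qNumber, Finset.sum_range_add, Finset.mul_sum, pow_add]

theorem qFactorial_pos {t : ℝ} (ht : 0 < t) (m : ℕ) : 0 < qFactorial t m :=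
  Finset.prod_pos fun _ _ => qNumber_succ_pos ht _

theorem qFactorial_succ (t : ℝ) (m : ℕ) :
    qFactorial t (m + 1) = qFactorial t m * qNumber t (m + 1) :=
  Finset.prod_range_succ _ _

theorem qMultiFactorial_pos {t : ℝ} (ht : 0 < t) {n : ℕ} (k : Fin n → ℕ) :
    0 < qMultiFactorial t k :=
  Finset.prod_pos fun _ _ => qFactorial_pos ht _

/-- The Gaussian binomial coefficient `[a+b]_t! / ([a]_t! [b]_t!)`. -/
def gauss (t : ℝ) (a b : ℕ) : ℝ :=
  qFactorial t (a + b) / (qFactorial t a * qFactorial t b)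

theorem gauss_pos {t : ℝ} (ht : 0 < t) (a b : ℕ) : 0 < gauss t a b :=
  div_pos (qFactorial_pos ht _) (mul_pos (qFactorial_pos ht _) (qFactorial_pos ht _))

theorem gauss_zero_right {t : ℝ} (ht : 0 < t) (a : ℕ) : gauss t a 0 = 1 := by
  have := (qFactorial_pos ht a).ne'
  simpa [gauss, qFactorial] using this

theorem gauss_zero_left {t : ℝ} (ht : 0 < t) (b : ℕ) : gauss t 0 b = 1 := by
  have := (qFactorial_pos ht b).ne'
  simpa [gauss, qFactorial] using this

theorem gauss_succ_succ {t : ℝ} (ht : 0 < t) (a b : ℕ) :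
    gauss t (a + 1) (b + 1) = gauss t a (b + 1) + t ^ (a + 1) * gauss t (a + 1) b := by
  have ha := (qFactorial_pos ht a).ne'
  have hb := (qFactorial_pos ht b).ne'
  have ha' := (qNumber_succ_pos ht a).ne'
  have hb' := (qNumber_succ_pos ht b).ne'
  have e1 : a + 1 + (b + 1) = (a + b + 1) + 1 := by ring
  have e2 : a + (b + 1) = a + b + 1 := by ring
  have e3 : a + 1 + b = a + b + 1 := by ring
  have h : qNumber t ((a + b + 1) + 1) = qNumber t (a + 1) + t ^ (a + 1) * qNumber t (b + 1) := by
    rw [← qNumber_add]; congr 1; ring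
  simp only [gauss, e1, e2, e3]
  rw [qFactorial_succ t (a + b + 1), h, qFactorial_succ t a, qFactorial_succ t b]
  field_simp

theorem gauss_le_succ_left {t : ℝ} (ht : 0 < t) (a b : ℕ) : gauss t a b ≤ gauss t (a + 1) b := by
  cases b with
  | zero => simp [gauss_zero_right ht]
  | succ b =>
    rw [gauss_succ_succ ht]
    have := gauss_pos ht (a + 1) b
    have := pow_pos ht (a + 1)
    nlinarith [mul_pos this ‹0 < gauss t (a + 1) b›]

theorem gauss_le_succ_right {t : ℝ} (ht : 0 < t) (a b : ℕ) :
    t ^ a * gauss t a b ≤ gauss t a (b + 1) := by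
  cases a with
  | zero => simp [gauss_zero_left ht]
  | succ a =>
    rw [gauss_succ_succ ht]
    linarith [gauss_pos ht a (b + 1)]

theorem gauss_mul_le {t : ℝ} (ht : 0 < t) (a b c d : ℕ) :
    gauss t a b * gauss t c d * t ^ (a * d) ≤ gauss t (a + c) (b + d) := by
  induction c generalizing d with
  | zero =>
    induction d with
    | zero => simp [gauss_zero_right ht]
    | succ d ih =>
      have h := gauss_le_succ_right ht a (b + d)
      simp only [gauss_zero_left ht, mul_one, Nat.add_zero] at ih ⊢
      calc gauss t a b * t ^ (a * (d + 1)) = t ^ a * (gauss t a b * t ^ (a * d)) := by ring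
        _ ≤ t ^ a * gauss t a (b + d) := by gcongr
        _ ≤ _ := h
  | succ c ihc =>
    induction d with
    | zero =>
      have h := ihc 0
      simp only [gauss_zero_right ht, mul_one, Nat.mul_zero, pow_zero, Nat.add_zero] at h ⊢
      exact h.trans (gauss_le_succ_left ht (a + c) b)
    | succ d ihd =>
      have h1 := ihc (d + 1)
      have h2 := mul_le_mul_of_nonneg_left ihd (pow_pos ht (a + c + 1)).le
      have h3 := gauss_succ_succ ht (a + c) (b + d)
      have h4 := gauss_succ_succ ht c d
      have e1 : a + (c + 1) = a + c + 1 := by ring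
      have e2 : b + (d + 1) = b + d + 1 := by ring
      rw [e1, e2, h3, h4]
      rw [e1] at h2
      rw [e2] at h1
      calc _ = gauss t a b * gauss t c (d + 1) * t ^ (a * (d + 1))
            + t ^ (a + c + 1) * (gauss t a b * gauss t (c + 1) d * t ^ (a * d)) := by ring
        _ ≤ _ := add_le_add h1 h2

/-- The inequality behind the submultiplicativity of the norms of the quantum ball. -/
theorem qMultinomial_mul_le {t : ℝ} (ht : 0 < t) {n : ℕ} (k l : Fin n → ℕ) :
    (qFactorial t (∑ i, k i) / qMultiFactorial t k)
      * (qFactorial t (∑ i, l i) / qMultiFactorial t l) * t ^ cross k l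
      ≤ qFactorial t (∑ i, (k + l) i) / qMultiFactorial t (k + l) := by
  induction n with
  | zero => simp [qMultiFactorial, qFactorial, cross]
  | succ n ih =>
    have key : ∀ m : Fin (n + 1) → ℕ, qFactorial t (∑ i, m i) / qMultiFactorial t m
        = (qFactorial t (∑ i : Fin n, m i.castSucc) /
            qMultiFactorial t (fun i : Fin n => m i.castSucc))
          * gauss t (∑ i : Fin n, m i.castSucc) (m (Fin.last n)) := by
      intro m
      have h1 := (qFactorial_pos ht (∑ i : Fin n, m i.castSucc)).ne'
      have h2 := (qFactorial_pos ht (m (Fin.last n))).ne'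
      have h3 := (qMultiFactorial_pos ht (fun i : Fin n => m i.castSucc)).ne'
      have h4 : qMultiFactorial t m = qMultiFactorial t (fun i : Fin n => m i.castSucc)
          * qFactorial t (m (Fin.last n)) := by
        simp [qMultiFactorial, Fin.prod_univ_castSucc]
      rw [h4, gauss, Fin.sum_univ_castSucc]
      field_simp
    rw [key k, key l, key (k + l), cross_castSucc, pow_add]
    have h1 := ih (fun i => k i.castSucc) (fun i => l i.castSucc)
    have h2 := gauss_mul_le ht (∑ i : Fin n, k i.castSucc) (k (Fin.last n))
      (∑ i : Fin n, l i.castSucc) (l (Fin.last n))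
    have h3 := (gauss_pos ht (∑ i : Fin n, k i.castSucc) (k (Fin.last n))).le
    have h4 := (gauss_pos ht (∑ i : Fin n, l i.castSucc) (l (Fin.last n))).le
    have h5 : 0 ≤ qFactorial t (∑ i, ((fun i : Fin n => k i.castSucc)
        + (fun i : Fin n => l i.castSucc)) i) / qMultiFactorial t
        ((fun i : Fin n => k i.castSucc) + (fun i : Fin n => l i.castSucc)) :=
      (div_pos (qFactorial_pos ht _) (qMultiFactorial_pos ht _)).le
    have h6 := mul_le_mul h1 h2
      (mul_nonneg (mul_nonneg h3 h4) (pow_pos ht _).le) h5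
    have e : ∑ i : Fin n, (k + l) i.castSucc
        = ∑ i : Fin n, k i.castSucc + ∑ i : Fin n, l i.castSucc := by
      simp [Finset.sum_add_distrib]
    have e' : (fun i : Fin n => (k + l) i.castSucc)
        = (fun i : Fin n => k i.castSucc) + (fun i : Fin n => l i.castSucc) := rfl
    have e'' : ∑ i, ((fun i : Fin n => k i.castSucc) + (fun i : Fin n => l i.castSucc)) i
        = ∑ i : Fin n, k i.castSucc + ∑ i : Fin n, l i.castSucc := e
    rw [e''] at h6
    rw [e, e', Pi.add_apply]
    refine le_trans (le_of_eq ?_) h6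
    ring

/-- Formal power series `∑_k c_k x^k`, `x^k = x_1^{k_1} ⋯ x_n^{k_n}`, in `n` variables satisfying
`x_i x_j = q x_j x_i` for `i < j`; a series is identified with its family of coefficients. -/
def QSeries (_q : ℂˣ) (n : ℕ) : Type := (Fin n →₀ ℕ) → ℂ

namespace QSeries

variable {q : ℂˣ} {n : ℕ}

instance : AddCommGroup (QSeries q n) := inferInstanceAs (AddCommGroup ((Fin n →₀ ℕ) → ℂ))

instance : Module ℂ (QSeries q n) := inferInstanceAs (Module ℂ ((Fin n →₀ ℕ) → ℂ))

/-- The coefficient of `x^k`. -/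
def coeff (k : Fin n →₀ ℕ) : QSeries q n →ₗ[ℂ] ℂ := LinearMap.proj k

@[ext] theorem ext {f g : QSeries q n} (h : ∀ k, coeff k f = coeff k g) : f = g := funext h

/-- The monomial `a x^k`. -/
def monomial (k : Fin n →₀ ℕ) (a : ℂ) : QSeries q n := fun l => if l = k then a else 0

theorem coeff_monomial (k l : Fin n →₀ ℕ) (a : ℂ) :
    coeff l (monomial k a : QSeries q n) = if l = k then a else 0 := rfl

/-- The scalar `c(k, l) = q^{-∑_{i > j} k_i l_j}`, for which `x^k x^l = c(k, l) x^{k+l}`. -/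
def twist (q : ℂˣ) (k l : Fin n →₀ ℕ) : ℂ := (((q⁻¹ : ℂˣ) : ℂ)) ^ cross l k

theorem twist_assoc (k l m : Fin n →₀ ℕ) :
    twist q k l * twist q (k + l) m = twist q l m * twist q k (l + m) := by
  simp only [twist, Finsupp.coe_add, cross_add_left, cross_add_right, pow_add]
  ring

theorem twist_zero_left (l : Fin n →₀ ℕ) : twist q 0 l = 1 := by
  simp [twist, cross_zero_right]

theorem twist_zero_right (l : Fin n →₀ ℕ) : twist q l 0 = 1 := by
  simp [twist, cross_zero_left]

instance : One (QSeries q n) := ⟨monomial 0 1⟩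

instance : Mul (QSeries q n) :=
  ⟨fun f g m => ∑ p ∈ Finset.HasAntidiagonal.antidiagonal m, twist q p.1 p.2 * (coeff p.1 f * coeff p.2 g)⟩

theorem coeff_one (k : Fin n →₀ ℕ) : coeff k (1 : QSeries q n) = if k = 0 then 1 else 0 := rfl

theorem coeff_mul (m : Fin n →₀ ℕ) (f g : QSeries q n) :
    coeff m (f * g)
      = ∑ p ∈ Finset.HasAntidiagonal.antidiagonal m, twist q p.1 p.2 * (coeff p.1 f * coeff p.2 g) := rfl

protected theorem one_mul (f : QSeries q n) : 1 * f = f := by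
  ext m
  rw [coeff_mul, Finset.sum_eq_single (0, m)]
  · simp [coeff_one, twist_zero_left]
  · rintro ⟨a, b⟩ hab hne
    have : a ≠ 0 := by
      rintro rfl
      simp_all
    simp [coeff_one, this]
  · simp

protected theorem mul_one (f : QSeries q n) : f * 1 = f := by
  ext m
  rw [coeff_mul, Finset.sum_eq_single (m, 0)]
  · simp [coeff_one, twist_zero_right]
  · rintro ⟨a, b⟩ hab hne
    have : b ≠ 0 := by
      rintro rfl
      simp_all
    simp [coeff_one, this]
  · simp

protected theorem mul_assoc (f g h : QSeries q n) : f * g * h = f * (g * h) := by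
  ext m
  simp only [coeff_mul, Finset.sum_mul, Finset.mul_sum, Finset.sum_sigma']
  refine Finset.sum_nbij' (fun ⟨⟨_i, j⟩, ⟨k, l⟩⟩ => ⟨(k, l + j), (l, j)⟩)
    (fun ⟨⟨i, _j⟩, ⟨k, l⟩⟩ => ⟨(i + k, l), (i, k)⟩) ?_ ?_ ?_ ?_ ?_
  · rintro ⟨⟨i, j⟩, ⟨k, l⟩⟩ h
    simp only [Finset.mem_sigma, Finset.HasAntidiagonal.mem_antidiagonal] at h ⊢
    obtain ⟨rfl, rfl⟩ := h
    exact ⟨by abel, trivial⟩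
  · rintro ⟨⟨i, j⟩, ⟨k, l⟩⟩ h
    simp only [Finset.mem_sigma, Finset.HasAntidiagonal.mem_antidiagonal] at h ⊢
    obtain ⟨rfl, rfl⟩ := h
    exact ⟨by abel, trivial⟩
  · rintro ⟨⟨i, j⟩, ⟨k, l⟩⟩ h
    simp only [Finset.mem_sigma, Finset.HasAntidiagonal.mem_antidiagonal] at h
    obtain ⟨rfl, rfl⟩ := h
    rfl
  · rintro ⟨⟨i, j⟩, ⟨k, l⟩⟩ h
    simp only [Finset.mem_sigma, Finset.HasAntidiagonal.mem_antidiagonal] at h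
    obtain ⟨rfl, rfl⟩ := h
    rfl
  · rintro ⟨⟨i, j⟩, ⟨k, l⟩⟩ h
    simp only [Finset.mem_sigma, Finset.HasAntidiagonal.mem_antidiagonal] at h
    obtain ⟨rfl, rfl⟩ := h
    have := twist_assoc (q := q) k l j
    linear_combination (coeff k f * coeff l g * coeff j ‹QSeries q n›) * this

instance : Ring (QSeries q n) :=
  { (inferInstance : AddCommGroup (QSeries q n)) with
    one_mul := QSeries.one_mul
    mul_one := QSeries.mul_one
    mul_assoc := QSeries.mul_assoc
    zero_mul := fun f => by ext m; simp [coeff_mul]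
    mul_zero := fun f => by ext m; simp [coeff_mul]
    left_distrib := fun f g h => by ext m; simp [coeff_mul, mul_add, Finset.sum_add_distrib]
    right_distrib := fun f g h => by
      ext m; simp [coeff_mul, mul_add, add_mul, Finset.sum_add_distrib] }

instance : Algebra ℂ (QSeries q n) :=
  Algebra.ofModule
    (fun a f g => by
      ext m
      simp only [coeff_mul, map_smul, smul_eq_mul, Finset.mul_sum]
      exact Finset.sum_congr rfl fun _ _ => by ring)
    (fun a f g => by
      ext m
      simp only [coeff_mul, map_smul, smul_eq_mul, Finset.mul_sum]
      exact Finset.sum_congr rfl fun _ _ => by ring)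

/-- The generator `x_i`. -/
def X (i : Fin n) : QSeries q n := monomial (Finsupp.single i 1) 1

theorem monomial_mul_monomial (k l : Fin n →₀ ℕ) (a b : ℂ) :
    (monomial k a * monomial l b : QSeries q n) = monomial (k + l) (twist q k l * (a * b)) := by
  ext m
  simp only [coeff_mul, coeff_monomial]
  split_ifs with h
  · rw [Finset.sum_eq_single (k, l)]
    · simp
    · rintro ⟨u, v⟩ _ hne
      by_cases hu : u = k
      · by_cases hv : v = l
        · exact absurd (by rw [hu, hv]) hne
        · simp [hv]
      · simp [hu]
    · simp [h]
  · refine Finset.sum_eq_zero ?_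
    rintro ⟨u, v⟩ huv
    rw [Finset.HasAntidiagonal.mem_antidiagonal] at huv
    by_cases hu : u = k
    · by_cases hv : v = l
      · exact absurd (by rw [← huv, hu, hv]) h
      · simp [hv]
    · simp [hu]

theorem cross_single {n : ℕ} (i j : Fin n) :
    cross (Finsupp.single i 1 : Fin n →₀ ℕ) (Finsupp.single j 1 : Fin n →₀ ℕ)
      = if i < j then 1 else 0 := by
  unfold cross
  rw [Finset.sum_eq_single i, Finset.sum_eq_single j]
  · simp
  · intro b _ hb; simp [hb]
  · simp
  · intro b _ hb; simp [Finsupp.single_apply, hb.symm]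
  · simp

/-- The defining relations `x_i x_j = q x_j x_i`, `i < j`. -/
theorem X_mul_X {i j : Fin n} (h : i < j) :
    (X i * X j : QSeries q n) = (q : ℂ) • (X j * X i) := by
  simp only [X, monomial_mul_monomial, twist, cross_single, h, h.asymm, if_true, if_false]
  ext m
  simp only [map_smul, coeff_monomial, smul_eq_mul]
  rw [add_comm (Finsupp.single j 1)]
  split_ifs <;> simp

end QSeries

open QSeries

/-- A weight `W` on multi-indices for which the weighted `ℓ¹`-norms
`∑_k |c_k| W(k) ρ^|k|` are submultiplicative. -/
structure Weight (q : ℂˣ) (n : ℕ) where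
  /-- The value of the weight at a multi-index. -/
  toFun : (Fin n →₀ ℕ) → ℝ
  pos : ∀ k, 0 < toFun k
  submul : ∀ k l, toFun (k + l) * ‖twist q k l‖ ≤ toFun k * toFun l

variable {q : ℂˣ} {n : ℕ}

/-- `w_q(k)`: equal to `1` if `|q| ≥ 1`, and to `|q|^{∑_{i<j} k_i k_j}` if `|q| < 1`. -/
def polydiskWeightFun (q : ℂˣ) {n : ℕ} (k : Fin n →₀ ℕ) : ℝ :=
  if 1 ≤ ‖(q : ℂ)‖ then 1 else ‖(q : ℂ)‖ ^ cross k k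

/-- `([k]_{|q|²}! / [|k|]_{|q|²}!)^{1/2} u_q(k)` with `u_q(k) = |q|^{∑_{i<j} k_i k_j}`. -/
def ballWeightFun (q : ℂˣ) {n : ℕ} (k : Fin n →₀ ℕ) : ℝ :=
  √(qMultiFactorial (‖(q : ℂ)‖ ^ 2) k / qFactorial (‖(q : ℂ)‖ ^ 2) k.degree)
    * ‖(q : ℂ)‖ ^ cross k k

theorem norm_pos_of_unit (q : ℂˣ) : 0 < ‖(q : ℂ)‖ := norm_pos_iff.2 q.ne_zero

theorem norm_twist (q : ℂˣ) (k l : Fin n →₀ ℕ) : ‖twist q k l‖ = (‖(q : ℂ)‖ ^ cross l k)⁻¹ := by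
  simp [twist]

theorem pow_cross_add (q : ℂˣ) (k l : Fin n →₀ ℕ) :
    ‖(q : ℂ)‖ ^ cross (k + l : Fin n →₀ ℕ) (k + l : Fin n →₀ ℕ) * ‖twist q k l‖
      = ‖(q : ℂ)‖ ^ cross k k * ‖(q : ℂ)‖ ^ cross l l * ‖(q : ℂ)‖ ^ cross k l := by
  have := (norm_pos_of_unit q).ne'
  simp only [norm_twist, Finsupp.coe_add, cross_add_left, cross_add_right, pow_add]
  field_simp

/-- The weight of the quantum polydisk. -/
def polydiskWeight (q : ℂˣ) (n : ℕ) : Weight q n where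
  toFun := polydiskWeightFun q
  pos k := by
    unfold polydiskWeightFun
    split_ifs
    · exact one_pos
    · exact pow_pos (norm_pos_of_unit q) _
  submul k l := by
    unfold polydiskWeightFun
    split_ifs with h
    · rw [norm_twist, one_mul, one_mul]
      exact inv_le_one_of_one_le₀ (one_le_pow₀ h)
    · rw [pow_cross_add]
      have h0 := norm_pos_of_unit q
      exact mul_le_of_le_one_right (by positivity) (pow_le_one₀ h0.le (not_le.1 h).le)

/-- The weight of the quantum ball. -/
def ballWeight (q : ℂˣ) (n : ℕ) : Weight q n where
  toFun := ballWeightFun q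
  pos k := by
    have h0 := norm_pos_of_unit q
    have h1 : 0 < ‖(q : ℂ)‖ ^ 2 := by positivity
    exact mul_pos (Real.sqrt_pos.2 (div_pos (qMultiFactorial_pos h1 _) (qFactorial_pos h1 _)))
      (pow_pos h0 _)
  submul k l := by
    have h0 := norm_pos_of_unit q
    have h1 : 0 < ‖(q : ℂ)‖ ^ 2 := by positivity
    have hdeg : ∀ m : Fin n →₀ ℕ, m.degree = ∑ i, m i := fun m => Finsupp.degree_eq_sum m
    have key : √(qMultiFactorial (‖(q : ℂ)‖ ^ 2) (k + l : Fin n →₀ ℕ)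
          / qFactorial (‖(q : ℂ)‖ ^ 2) (k + l).degree) * ‖(q : ℂ)‖ ^ cross k l
        ≤ √(qMultiFactorial (‖(q : ℂ)‖ ^ 2) k / qFactorial (‖(q : ℂ)‖ ^ 2) k.degree)
          * √(qMultiFactorial (‖(q : ℂ)‖ ^ 2) l / qFactorial (‖(q : ℂ)‖ ^ 2) l.degree) := by
      have hs : ‖(q : ℂ)‖ ^ cross k l = √((‖(q : ℂ)‖ ^ 2) ^ cross k l) := by
        rw [← pow_mul, mul_comm, pow_mul, Real.sqrt_sq (by positivity)]
      have A := qMultiFactorial_pos h1 k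
      have B := qMultiFactorial_pos h1 l
      have C := qMultiFactorial_pos h1 (k + l : Fin n →₀ ℕ)
      have A' := qFactorial_pos h1 k.degree
      have B' := qFactorial_pos h1 l.degree
      have C' := qFactorial_pos h1 (k + l).degree
      rw [hs, ← Real.sqrt_mul (by positivity), ← Real.sqrt_mul (by positivity)]
      apply Real.sqrt_le_sqrt
      have h := qMultinomial_mul_le h1 (k : Fin n → ℕ) (l : Fin n → ℕ)
      rw [← Finsupp.coe_add, ← hdeg, ← hdeg, ← hdeg] at h
      rw [div_mul_div_comm, div_mul_eq_mul_div, div_le_div_iff₀ (by positivity) C] at h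
      rw [div_mul_div_comm, div_mul_eq_mul_div, div_le_div_iff₀ C' (by positivity)]
      linarith
    change ballWeightFun q (k + l) * _ ≤ ballWeightFun q k * ballWeightFun q l
    unfold ballWeightFun
    rw [mul_assoc, pow_cross_add]
    calc _ = (√(qMultiFactorial (‖(q : ℂ)‖ ^ 2) (k + l : Fin n →₀ ℕ)
          / qFactorial (‖(q : ℂ)‖ ^ 2) (k + l).degree) * ‖(q : ℂ)‖ ^ cross k l)
          * (‖(q : ℂ)‖ ^ cross k k * ‖(q : ℂ)‖ ^ cross l l) := by ring
      _ ≤ _ := mul_le_mul_of_nonneg_right key (by positivity)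
      _ = _ := by ring

namespace Weight

variable (W : Weight q n)

/-- The general term `|c_k| W(k) ρ^|k|` of the norm series. -/
def term (ρ : ℝ) (f : QSeries q n) (k : Fin n →₀ ℕ) : ℝ :=
  ‖coeff k f‖ * W.toFun k * ρ ^ k.degree

theorem term_nonneg {ρ : ℝ} (hρ : 0 ≤ ρ) (f : QSeries q n) (k : Fin n →₀ ℕ) :
    0 ≤ W.term ρ f k :=
  mul_nonneg (mul_nonneg (norm_nonneg _) (W.pos k).le) (pow_nonneg hρ _)

theorem term_add_le {ρ : ℝ} (hρ : 0 ≤ ρ) (f g : QSeries q n) (k : Fin n →₀ ℕ) :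
    W.term ρ (f + g) k ≤ W.term ρ f k + W.term ρ g k := by
  have := (W.pos k).le
  have := pow_nonneg hρ k.degree
  calc W.term ρ (f + g) k
      ≤ (‖coeff k f‖ + ‖coeff k g‖) * W.toFun k * ρ ^ k.degree := by
        unfold term
        rw [map_add]
        gcongr
        exact norm_add_le _ _
    _ = _ := by unfold term; ring

theorem term_smul (ρ : ℝ) (a : ℂ) (f : QSeries q n) (k : Fin n →₀ ℕ) :
    W.term ρ (a • f) k = ‖a‖ * W.term ρ f k := by
  simp only [term, map_smul, smul_eq_mul, norm_mul]; ring

theorem summable_add {ρ : ℝ} (hρ : 0 ≤ ρ) {f g : QSeries q n} (hf : Summable (W.term ρ f))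
    (hg : Summable (W.term ρ g)) : Summable (W.term ρ (f + g)) :=
  Summable.of_nonneg_of_le (W.term_nonneg hρ _) (W.term_add_le hρ f g) (hf.add hg)

theorem term_mul_le {ρ : ℝ} (hρ : 0 ≤ ρ) (f g : QSeries q n) (m : Fin n →₀ ℕ) :
    W.term ρ (f * g) m
      ≤ ∑ p ∈ Finset.HasAntidiagonal.antidiagonal m, W.term ρ f p.1 * W.term ρ g p.2 := by
  have h1 := (W.pos m).le
  have h2 := pow_nonneg hρ m.degree
  calc W.term ρ (f * g) m
      ≤ (∑ p ∈ Finset.HasAntidiagonal.antidiagonal m, ‖twist q p.1 p.2 * (coeff p.1 f * coeff p.2 g)‖)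
          * W.toFun m * ρ ^ m.degree := by
        unfold term
        rw [coeff_mul]
        gcongr
        exact norm_sum_le _ _
    _ ≤ _ := by
        rw [Finset.sum_mul, Finset.sum_mul]
        refine Finset.sum_le_sum ?_
        rintro ⟨k, l⟩ hkl
        rw [Finset.HasAntidiagonal.mem_antidiagonal] at hkl
        subst hkl
        have h3 := W.submul k l
        simp only [term, norm_mul, map_add, pow_add]
        calc _ = (W.toFun (k + l) * ‖twist q k l‖)
              * (‖coeff k f‖ * ‖coeff l g‖ * (ρ ^ k.degree * ρ ^ l.degree)) := by ring
          _ ≤ (W.toFun k * W.toFun l)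
              * (‖coeff k f‖ * ‖coeff l g‖ * (ρ ^ k.degree * ρ ^ l.degree)) :=
            mul_le_mul_of_nonneg_right h3 (by positivity)
          _ = _ := by ring

theorem summable_mul {ρ : ℝ} (hρ : 0 ≤ ρ) {f g : QSeries q n} (hf : Summable (W.term ρ f))
    (hg : Summable (W.term ρ g)) : Summable (W.term ρ (f * g)) :=
  Summable.of_nonneg_of_le (W.term_nonneg hρ _) (W.term_mul_le hρ f g)
    (summable_sum_mul_antidiagonal_of_summable_mul
      (hf.mul_of_nonneg hg (W.term_nonneg hρ f) (W.term_nonneg hρ g)))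

theorem summable_algebraMap (ρ : ℝ) (a : ℂ) :
    Summable (W.term ρ (algebraMap ℂ (QSeries q n) a)) := by
  refine summable_of_ne_finset_zero (s := {0}) fun k hk => ?_
  have hk' : k ≠ 0 := by simpa using hk
  rw [Algebra.algebraMap_eq_smul_one, term_smul]
  simp [term, coeff_one, hk']

/-- The algebra of all series `∑_k c_k x^k` with `∑_k |c_k| W(k) ρ^|k| < ∞` for all
`ρ ∈ (0, r)`. -/
def algebra (r : ℝ) : Subalgebra ℂ (QSeries q n) where
  carrier := {f | ∀ ρ ∈ Set.Ioo 0 r, Summable (W.term ρ f)}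
  mul_mem' hf hg ρ hρ := W.summable_mul hρ.1.le (hf ρ hρ) (hg ρ hρ)
  add_mem' hf hg ρ hρ := W.summable_add hρ.1.le (hf ρ hρ) (hg ρ hρ)
  algebraMap_mem' a ρ _ := W.summable_algebraMap ρ a

/-- The norm `‖f‖_ρ = ∑_k |c_k| W(k) ρ^|k|`, for `ρ ∈ (0, r)`. -/
def norm (r : ℝ) (ρ : Set.Ioo (0 : ℝ) r) : Seminorm ℂ (W.algebra r) :=
  Seminorm.of (fun f => ∑' k, W.term ρ f k)
    (fun f g => by
      have hf := f.2 ρ ρ.2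
      have hg := g.2 ρ ρ.2
      rw [← hf.tsum_add hg]
      exact (W.summable_add ρ.2.1.le hf hg).tsum_le_tsum (W.term_add_le ρ.2.1.le f g)
        (hf.add hg))
    (fun a f => by
      simp only [Subalgebra.coe_smul, term_smul]
      exact tsum_mul_left)

/-- The locally convex topology generated by the norms `‖·‖_ρ`, `ρ ∈ (0, r)`. -/
instance (r : ℝ) : TopologicalSpace (W.algebra r) :=
  ⨅ ρ : Set.Ioo (0 : ℝ) r,
    (W.norm r ρ).toSeminormedAddCommGroup.toUniformSpace.toTopologicalSpace

end Weight

/-- The algebra `𝒪_q(𝔻_r^n)` of holomorphic functions on the quantum polydisk. -/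
abbrev QuantumPolydisk (q : ℂˣ) (n : ℕ) (r : ℝ) : Type := (polydiskWeight q n).algebra r

/-- The algebra `𝒪_q(𝔹_r^n)` of holomorphic functions on the quantum ball. -/
abbrev QuantumBall (q : ℂˣ) (n : ℕ) (r : ℝ) : Type := (ballWeight q n).algebra r

end QuantumHolomorphic

end

noncomputable section

namespace QuantumHolomorphic

open QSeries Filter Topology Metric

variable {q : ℂˣ} {n : ℕ}

/-! Since |q| = 1, the polydisk weight is identically 1, while the ball weight is 1 on powers of one
generator and decays like 2^(-m/2) on x_i^m x_j^m. The invariants used are continuous characters and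
continuous point derivations. Both are determined by their values on the generators (`char_ext`,
`IsPointDerivation.ext`), because monomials span a dense subspace.

Case q ≠ 1. If a character is nonzero on x_l, the relations force every point derivation there to
vanish on all other generators, so continuous derivations form a space of dimension at most 1. At
the constant-term character the n ≥ 2 linear coefficients are independent. Hence an isomorphism
preserves constant terms (`aug_map_gen_eq_zero`), and its linear part is invertible
(`sum_lin_mul_lin`). Coefficients of x_a^2 in the relations show that this matrix has one nonzero
entry in each row and column. Continuity on the powers x_i^m bounds these entries by 1 in modulus.
The inverse then sends the products of m-th powers, exponentially small in the ball, to elements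
whose leading coefficient has modulus at least 1, and the polydisk norms rule this out
(`not_iso_of_ne_one`).

Case q = 1. This is Poincaré's theorem that polydisk and ball are not biholomorphic, done
infinitesimally. Points are characters, and tangent vectors are derivatives along analytic discs.
Schwarz and Schwarz–Pick estimates, `exists_derivation` and `norm_derivation_map_gen_le`, compare a
rescaled sup norm on the tangent space of the polydisk with the Euclidean norm on that of the ball.
The parallelogram law makes the two incompatible (`not_iso_of_eq_one`). -/

/-- If `a^m` is dominated by `b^m` up to a polynomial factor, then `a ≤ b`. -/
theorem le_of_pow_le_mul_pow {a b C : ℝ} (N : ℕ) (hb : 0 ≤ b)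
    (h : ∀ m : ℕ, a ^ m ≤ C * ((m : ℝ) + 1) ^ N * b ^ m) : a ≤ b := by
  by_contra! hab
  have ha0 : 0 < a := hb.trans_lt hab
  have hC : 0 ≤ C := by have := h 0; simp at this; linarith
  -- The ratio b / a may be 0. Replacing b by the larger `max b (a / 2)`, still below a, keeps t in
  -- (0, 1), so that division by t is allowed.
  set t : ℝ := max b (a / 2) / a with ht
  have ht0 : 0 < t := div_pos (lt_max_of_lt_right (by linarith)) ha0
  have ht1 : t < 1 := (div_lt_one ha0).2 (max_lt hab (by linarith))
  have hlim := (tendsto_pow_const_mul_const_pow_of_abs_lt_one N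
    (r := t) (by rwa [abs_of_pos ht0])).comp (tendsto_add_atTop_nat 1)
  have hlim' := (hlim.const_mul (C / t))
  rw [mul_zero] at hlim'
  have h1 : ∀ m : ℕ, (1 : ℝ) ≤ C / t * (((m + 1 : ℕ) : ℝ) ^ N * t ^ (m + 1)) := by
    intro m
    have e : C / t * (((m + 1 : ℕ) : ℝ) ^ N * t ^ (m + 1))
        = (C * ((m : ℝ) + 1) ^ N * (max b (a / 2)) ^ m) / a ^ m := by
      rw [pow_succ]
      push_cast
      field_simp
      rw [ht, div_pow]
      field_simp
    rw [e, one_le_div (pow_pos ha0 m)]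
    refine (h m).trans ?_
    gcongr
    exact le_max_left _ _
  have := ge_of_tendsto' hlim' h1
  linarith

/-! ### Monomials, norms and continuity in the weighted algebras -/

namespace Weight

variable (W : Weight q n) {r : ℝ}

theorem summable_monomial (ρ : ℝ) (k : Fin n →₀ ℕ) (a : ℂ) :
    Summable (W.term ρ (monomial k a)) :=
  summable_of_ne_finset_zero (s := {k}) fun l hl => by
    have hne : l ≠ k := by simpa using hl
    simp [term, coeff_monomial, hne]

/-- The monomial `x^k` as an element of the algebra. -/
def mono (r : ℝ) (k : Fin n →₀ ℕ) : W.algebra r :=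
  ⟨monomial k 1, fun ρ _ => W.summable_monomial ρ k 1⟩

/-- The generator `x_i` as an element of the algebra. -/
def gen (r : ℝ) (i : Fin n) : W.algebra r := W.mono r (Finsupp.single i 1)

theorem coe_mono (k : Fin n →₀ ℕ) : (W.mono r k : QSeries q n) = monomial k 1 := rfl

theorem coe_gen (i : Fin n) : (W.gen r i : QSeries q n) = X i := rfl

theorem mono_zero : W.mono r 0 = 1 := rfl

theorem gen_mul_mono (i : Fin n) (k : Fin n →₀ ℕ) :
    W.gen r i * W.mono r k
      = twist q (Finsupp.single i 1) k • W.mono r (Finsupp.single i 1 + k) := by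
  apply Subtype.ext
  change (monomial _ 1 * monomial k 1 : QSeries q n) = _ • monomial _ 1
  rw [monomial_mul_monomial]
  ext m
  simp [coeff_monomial]

theorem gen_pow (i : Fin n) (m : ℕ) :
    W.gen r i ^ m = W.mono r (Finsupp.single i m) := by
  induction m with
  | zero => simp [mono_zero]
  | succ m ih =>
    rw [pow_succ', ih, gen_mul_mono]
    have : cross (Finsupp.single i m : Fin n →₀ ℕ) (Finsupp.single i 1 : Fin n →₀ ℕ) = 0 := by
      unfold cross
      refine Finset.sum_eq_zero fun a _ => Finset.sum_eq_zero fun b _ => ?_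
      by_cases ha : i = a
      · subst ha
        split_ifs with h
        · simp [h.ne]
        · rfl
      · simp [ha]
    rw [twist, this, pow_zero, one_smul, ← Finsupp.single_add, add_comm]

theorem gen_mul_gen {i j : Fin n} (h : i < j) :
    W.gen r i * W.gen r j = (q : ℂ) • (W.gen r j * W.gen r i) :=
  Subtype.ext (X_mul_X h)

/-- A submodule containing `1` and stable under left multiplication by the generators contains all
monomials. -/
theorem mono_mem (N : Submodule ℂ (W.algebra r)) (h1 : (1 : W.algebra r) ∈ N)
    (h : ∀ i, ∀ a ∈ N, W.gen r i * a ∈ N) (k : Fin n →₀ ℕ) : W.mono r k ∈ N := by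
  induction k using Finsupp.induction with
  | zero => exact h1
  | single_add i m k hi hm ih =>
    clear hi hm
    induction m with
    | zero => simpa using ih
    | succ m ih' =>
      have e : Finsupp.single i (m + 1) + k = Finsupp.single i 1 + (Finsupp.single i m + k) := by
        rw [add_comm m, Finsupp.single_add, add_assoc]
      have hm := h i _ ih'
      rw [gen_mul_mono] at hm
      rw [e]
      exact (Submodule.smul_mem_iff N (pow_ne_zero _ (q⁻¹).ne_zero)).1 hm

theorem norm_apply (ρ : Set.Ioo (0 : ℝ) r) (f : W.algebra r) :
    W.norm r ρ f = ∑' k, W.term ρ f k := rfl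

theorem norm_mono (ρ : Set.Ioo (0 : ℝ) r) (k : Fin n →₀ ℕ) :
    W.norm r ρ (W.mono r k) = W.toFun k * (ρ : ℝ) ^ k.degree := by
  rw [norm_apply, tsum_eq_single k]
  · simp [term, coe_mono, coeff_monomial]
  · intro l hl
    simp [term, coe_mono, coeff_monomial, hl]

theorem term_le_norm (ρ : Set.Ioo (0 : ℝ) r) (f : W.algebra r) (k : Fin n →₀ ℕ) :
    W.term ρ f k ≤ W.norm r ρ f :=
  (f.2 ρ ρ.2).le_tsum k fun l _ => W.term_nonneg ρ.2.1.le f l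

theorem norm_mono_radius {ρ ρ' : Set.Ioo (0 : ℝ) r} (h : (ρ : ℝ) ≤ ρ') (f : W.algebra r) :
    W.norm r ρ f ≤ W.norm r ρ' f := by
  refine (f.2 ρ ρ.2).tsum_le_tsum (fun k => ?_) (f.2 ρ' ρ'.2)
  have := (W.pos k).le
  have := ρ.2.1.le
  unfold term
  gcongr

instance : IsTopologicalAddGroup (W.algebra r) :=
  topologicalAddGroup_iInf fun ρ =>
    letI := (W.norm r ρ).toSeminormedAddCommGroup
    inferInstance

theorem withSeminorms (r : ℝ) :
    WithSeminorms (𝕜 := ℂ) (E := W.algebra r) (ι := Set.Ioo (0 : ℝ) r) (W.norm r) :=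
  (SeminormFamily.withSeminorms_iff_topologicalSpace_eq_iInf _).2 rfl

theorem exists_radius (hr : 0 < r) (s : Finset (Set.Ioo (0 : ℝ) r)) :
    ∃ ρ : Set.Ioo (0 : ℝ) r, s.sup (W.norm r) ≤ W.norm r ρ := by
  -- Needed for the empty set s, where any radius serves.
  have : Nonempty (Set.Ioo (0 : ℝ) r) := (Set.nonempty_Ioo.2 hr).to_subtype
  obtain ⟨ρ, hρ⟩ := s.exists_le
  exact ⟨ρ, Finset.sup_le fun σ hσ f => W.norm_mono_radius (hρ σ hσ) f⟩

/-- A continuous seminorm is dominated by one of the norms `‖·‖_ρ`. -/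
theorem exists_le_norm_of_continuous (hr : 0 < r) (p : Seminorm ℂ (W.algebra r))
    (hp : Continuous p) :
    ∃ ρ : Set.Ioo (0 : ℝ) r, ∃ C : ℝ, 0 < C ∧ ∀ a, p a ≤ C * W.norm r ρ a := by
  obtain ⟨s, C, hC, h⟩ := Seminorm.bound_of_continuous (W.withSeminorms r) p hp
  obtain ⟨ρ, hρ⟩ := W.exists_radius hr s
  refine ⟨ρ, C, by positivity, fun a => (h a).trans ?_⟩
  change (C : ℝ) * (s.sup (W.norm r)) a ≤ _
  exact mul_le_mul_of_nonneg_left (hρ a) C.2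

/-- The pulled-back norm is a continuous seminorm. The radius ρ' may exceed ρ, but it stays strictly
below r; the estimates for q ≠ 1 exploit exactly this. -/
theorem exists_norm_map_le (hr : 0 < r) {W' : Weight q n}
    (φ : W.algebra r →ₗ[ℂ] W'.algebra r) (hφ : Continuous φ) (ρ : Set.Ioo (0 : ℝ) r) :
    ∃ ρ' : Set.Ioo (0 : ℝ) r, ∃ C : ℝ, 0 < C ∧ ∀ a, W'.norm r ρ (φ a) ≤ C * W.norm r ρ' a :=
  W.exists_le_norm_of_continuous hr ((W'.norm r ρ).comp φ)
    (((W'.withSeminorms r).continuous_seminorm ρ).comp hφ)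

theorem continuous_of_norm_le (u : W.algebra r →ₗ[ℂ] ℂ) (ρ : Set.Ioo (0 : ℝ) r) {C : ℝ}
    (hC : 0 ≤ C) (h : ∀ a, ‖u a‖ ≤ C * W.norm r ρ a) : Continuous u := by
  refine WithSeminorms.continuous_normedSpace_rng (p := W.norm r) ℂ (W.withSeminorms r) u
    ⟨{ρ}, ⟨C, hC⟩, fun a => ?_⟩
  rw [Finset.sup_singleton]
  exact h a

theorem continuous_coeff (hr : 0 < r) (k : Fin n →₀ ℕ) :
    Continuous fun a : W.algebra r => coeff k (a : QSeries q n) := by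
  obtain ⟨ρ, hρ⟩ := Set.nonempty_Ioo.2 hr
  have h0 : 0 < W.toFun k * ρ ^ k.degree := mul_pos (W.pos k) (pow_pos hρ.1 _)
  refine W.continuous_of_norm_le ((coeff k).comp (W.algebra r).val.toLinearMap) ⟨ρ, hρ⟩
    (inv_pos.2 h0).le fun a => ?_
  rw [inv_mul_eq_div, le_div_iff₀ h0, ← mul_assoc]
  exact W.term_le_norm ⟨ρ, hρ⟩ a k

/-- In each norm the error of a finite partial sum is the tail of the convergent norm series.
Continuous functionals are therefore determined by their values on monomials. -/
theorem hasSum_mono (a : W.algebra r) :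
    HasSum (fun k => coeff k (a : QSeries q n) • W.mono r k) a := by
  rw [HasSum, SummationFilter.unconditional_filter, (W.withSeminorms r).tendsto_nhds]
  intro ρ ε hε
  have hlim := tendsto_tsum_compl_atTop_zero (W.term ρ (a : QSeries q n))
  filter_upwards [hlim.eventually_lt_const hε] with s hs
  refine lt_of_le_of_lt (le_of_eq ?_) hs
  rw [map_sub_rev, norm_apply]
  refine Eq.trans ?_ (tsum_subtype {l | l ∉ s} (W.term ρ (a : QSeries q n))).symm
  refine tsum_congr fun l => ?_
  have e : coeff l ((∑ k ∈ s, coeff k (a : QSeries q n) • W.mono r k : W.algebra r) : QSeries q n)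
      = if l ∈ s then coeff l (a : QSeries q n) else 0 := by
    rw [AddSubmonoidClass.coe_finsetSum, map_sum]
    simp only [Subalgebra.coe_smul, map_smul, coe_mono, coeff_monomial, smul_eq_mul, mul_ite,
      mul_one, mul_zero]
    rw [Finset.sum_ite_eq]
  unfold term
  rw [AddSubgroupClass.coe_sub, map_sub, e]
  by_cases hl : l ∈ s
  · simp [hl]
  · simp [hl]

/-! ### Characters and point derivations are determined on generators -/

/-- A continuous functional whose kernel contains `1` and is stable under left multiplication by
the generators vanishes. -/
theorem eq_zero_of_ker (u : W.algebra r →ₗ[ℂ] ℂ) (hu : Continuous u) (h1 : u 1 = 0)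
    (h : ∀ i a, u a = 0 → u (W.gen r i * a) = 0) : u = 0 := by
  have hk : ∀ k, u (W.mono r k) = 0 := fun k =>
    W.mono_mem (LinearMap.ker u) h1 (fun i a ha => h i a ha) k
  ext a
  have := (W.hasSum_mono a).map u hu
  have h0 : (u ∘ fun k => coeff k (a : QSeries q n) • W.mono r k) = fun _ => 0 := by
    ext k; simp [hk]
  rw [h0] at this
  simpa using this.unique hasSum_zero

/-- Continuous characters agreeing on the generators agree. -/
theorem char_ext (χ χ' : W.algebra r →ₐ[ℂ] ℂ) (hχ : Continuous χ) (hχ' : Continuous χ')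
    (h : ∀ i, χ (W.gen r i) = χ' (W.gen r i)) : χ = χ' := by
  have := W.eq_zero_of_ker (χ.toLinearMap - χ'.toLinearMap) (hχ.sub hχ') (by simp)
    (fun i a ha => by
      simp only [LinearMap.sub_apply, AlgHom.toLinearMap_apply, map_mul, h] at ha ⊢
      rw [← mul_sub, ha, mul_zero])
  ext a
  simpa [sub_eq_zero] using LinearMap.congr_fun this a

/-- A point derivation at the character `χ`. -/
def IsPointDerivation (χ : W.algebra r →ₐ[ℂ] ℂ) (d : W.algebra r →ₗ[ℂ] ℂ) : Prop :=
  ∀ a b, d (a * b) = χ a * d b + d a * χ b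

variable {W}

theorem IsPointDerivation.map_one {χ : W.algebra r →ₐ[ℂ] ℂ} {d : W.algebra r →ₗ[ℂ] ℂ}
    (hd : W.IsPointDerivation χ d) : d 1 = 0 := by
  have := hd 1 1
  simpa using this

/-- Continuous point derivations agreeing on the generators agree. -/
theorem IsPointDerivation.ext {χ : W.algebra r →ₐ[ℂ] ℂ} {d d' : W.algebra r →ₗ[ℂ] ℂ}
    (hd : W.IsPointDerivation χ d) (hd' : W.IsPointDerivation χ d')
    (hc : Continuous d) (hc' : Continuous d') (h : ∀ i, d (W.gen r i) = d' (W.gen r i)) :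
    d = d' := by
  rw [← sub_eq_zero]
  refine W.eq_zero_of_ker (d - d') (hc.sub hc') (by simp [hd.map_one, hd'.map_one])
    fun i a ha => ?_
  simp only [LinearMap.sub_apply] at ha ⊢
  rw [hd, hd', h]
  linear_combination χ (W.gen r i) * ha

theorem IsPointDerivation.add {χ : W.algebra r →ₐ[ℂ] ℂ} {d d' : W.algebra r →ₗ[ℂ] ℂ}
    (hd : W.IsPointDerivation χ d) (hd' : W.IsPointDerivation χ d') :
    W.IsPointDerivation χ (d + d') := fun a b => by
  simp only [LinearMap.add_apply, hd a b, hd' a b]; ring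

theorem IsPointDerivation.smul {χ : W.algebra r →ₐ[ℂ] ℂ} {d : W.algebra r →ₗ[ℂ] ℂ} (c : ℂ)
    (hd : W.IsPointDerivation χ d) : W.IsPointDerivation χ (c • d) := fun a b => by
  simp only [LinearMap.smul_apply, hd a b, smul_eq_mul]; ring

theorem IsPointDerivation.sum {ι : Type*} {χ : W.algebra r →ₐ[ℂ] ℂ}
    {d : ι → W.algebra r →ₗ[ℂ] ℂ} (s : Finset ι) (hd : ∀ i ∈ s, W.IsPointDerivation χ (d i)) :
    W.IsPointDerivation χ (∑ i ∈ s, d i) := fun a b => by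
  simp only [LinearMap.sum_apply, Finset.mul_sum, Finset.sum_mul, ← Finset.sum_add_distrib]
  exact Finset.sum_congr rfl fun i hi => hd i hi a b

theorem IsPointDerivation.comp {W' : Weight q n} {χ : W'.algebra r →ₐ[ℂ] ℂ}
    {d : W'.algebra r →ₗ[ℂ] ℂ} (hd : W'.IsPointDerivation χ d)
    (φ : W.algebra r →ₐ[ℂ] W'.algebra r) :
    W.IsPointDerivation (χ.comp φ) (d.comp φ.toLinearMap) := fun a b => by
  simp [hd (φ a) (φ b)]

end Weight

/-! ### Order filtration and leading terms -/

namespace QSeries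

/-- The series without terms of degree less than `d`. -/
def orderGE (q : ℂˣ) (n d : ℕ) : Submodule ℂ (QSeries q n) where
  carrier := {f | ∀ k : Fin n →₀ ℕ, k.degree < d → coeff k f = 0}
  add_mem' hf hg k hk := by rw [map_add, hf k hk, hg k hk, add_zero]
  zero_mem' k _ := map_zero _
  smul_mem' c f hf k hk := by rw [map_smul, hf k hk, smul_zero]

theorem mul_mem_orderGE {d e : ℕ} {f g : QSeries q n} (hf : f ∈ orderGE q n d)
    (hg : g ∈ orderGE q n e) : f * g ∈ orderGE q n (d + e) := by
  intro k hk
  rw [coeff_mul]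
  refine Finset.sum_eq_zero fun p hp => ?_
  rw [Finset.HasAntidiagonal.mem_antidiagonal] at hp
  rw [← hp, map_add] at hk
  rcases lt_or_ge p.1.degree d with h | h
  · rw [hf _ h]; ring
  · rw [hg p.2 (by omega)]; ring

/-- Leading forms multiply: the difference splits as (f - f')g + f'(g - g'), an identity that needs
no commutativity. -/
theorem mul_sub_mul_mem_orderGE {d e : ℕ} {f f' g g' : QSeries q n}
    (hf' : f' ∈ orderGE q n d) (hg : g ∈ orderGE q n e)
    (hff' : f - f' ∈ orderGE q n (d + 1)) (hgg' : g - g' ∈ orderGE q n (e + 1)) :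
    f * g - f' * g' ∈ orderGE q n (d + e + 1) := by
  have h : f * g - f' * g' = (f - f') * g + f' * (g - g') := by noncomm_ring
  rw [h]
  refine add_mem ?_ (by simpa only [add_assoc] using mul_mem_orderGE hf' hgg')
  have := mul_mem_orderGE hff' hg
  rwa [add_right_comm] at this

theorem pow_mem_orderGE {f : QSeries q n} (hf : f ∈ orderGE q n 1) (m : ℕ) :
    f ^ m ∈ orderGE q n m := by
  induction m with
  | zero => intro k hk; omega
  | succ m ih => rw [pow_succ]; exact mul_mem_orderGE ih hf

theorem pow_sub_pow_mem_orderGE {f g : QSeries q n} (hf : f ∈ orderGE q n 1)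
    (hg : g ∈ orderGE q n 1) (h : f - g ∈ orderGE q n 2) (m : ℕ) :
    f ^ m - g ^ m ∈ orderGE q n (m + 1) := by
  induction m with
  | zero => simp
  | succ m ih =>
    rw [pow_succ, pow_succ]
    exact mul_sub_mul_mem_orderGE (pow_mem_orderGE hg m) hf ih h

theorem mem_orderGE_one {f : QSeries q n} (h : coeff 0 f = 0) : f ∈ orderGE q n 1 := by
  intro k hk
  have : k = 0 := (Finsupp.degree_eq_zero_iff k).1 (by omega)
  rw [this, h]

theorem X_mem_orderGE (i : Fin n) : (X i : QSeries q n) ∈ orderGE q n 1 := by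
  refine mem_orderGE_one ?_
  rw [X, coeff_monomial, if_neg]
  exact fun h => by simpa using DFunLike.congr_fun h i

theorem mem_orderGE_two {f : QSeries q n} (h : coeff 0 f = 0)
    (h' : ∀ i, coeff (Finsupp.single i 1) f = 0) : f ∈ orderGE q n 2 := by
  intro k hk
  rcases Nat.lt_or_ge k.degree 1 with h1 | h1
  · exact mem_orderGE_one h k h1
  · obtain ⟨i, rfl⟩ : ∃ i, k = Finsupp.single i 1 := by
      have : k.degree = 1 := by omega
      exact (Finsupp.sum_eq_one_iff k).1 this
    exact h' i

theorem coeff_zero_mul (f g : QSeries q n) : coeff 0 (f * g) = coeff 0 f * coeff 0 g := by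
  rw [coeff_mul]
  simp [twist_zero_left]

/-- Powers of a single generator commute, so the twist is 1 and the coefficients along one axis
multiply as in an ordinary one-variable series. -/
theorem coeff_single_mul (i : Fin n) (m : ℕ) (f g : QSeries q n) :
    coeff (Finsupp.single i m) (f * g) = ∑ p ∈ Finset.HasAntidiagonal.antidiagonal m,
      coeff (Finsupp.single i p.1) f * coeff (Finsupp.single i p.2) g := by
  rw [coeff_mul, Finsupp.antidiagonal_single, Finset.sum_map]
  refine Finset.sum_congr rfl fun p _ => ?_
  have : cross (Finsupp.single i p.2 : Fin n →₀ ℕ) (Finsupp.single i p.1 : Fin n →₀ ℕ) = 0 := by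
    unfold cross
    refine Finset.sum_eq_zero fun a _ => Finset.sum_eq_zero fun b _ => ?_
    split_ifs with h
    · by_cases ha : i = a
      · subst ha
        simp [h.ne]
      · simp [ha]
    · rfl
  simp [twist, this]

end QSeries

/-! ### The constant-term character and linear parts of isomorphisms -/

namespace Weight

variable (W : Weight q n) {r : ℝ}

/-- The constant term, as a character. -/
def aug (r : ℝ) : W.algebra r →ₐ[ℂ] ℂ :=
  AlgHom.ofLinearMap ((coeff 0).comp (W.algebra r).val.toLinearMap)
    (by simp [coeff_one]) (fun a b => by simp [coeff_zero_mul])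

/-- The coefficient of `x_i`. -/
def lin (r : ℝ) (i : Fin n) : W.algebra r →ₗ[ℂ] ℂ :=
  (coeff (Finsupp.single i 1)).comp (W.algebra r).val.toLinearMap

theorem aug_apply (a : W.algebra r) : W.aug r a = coeff 0 (a : QSeries q n) := rfl

theorem lin_apply (i : Fin n) (a : W.algebra r) :
    W.lin r i a = coeff (Finsupp.single i 1) (a : QSeries q n) := rfl

theorem continuous_aug (hr : 0 < r) : Continuous (W.aug r) := W.continuous_coeff hr 0

theorem continuous_lin (hr : 0 < r) (i : Fin n) : Continuous (W.lin r i) :=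
  W.continuous_coeff hr _

theorem isPointDerivation_lin (i : Fin n) : W.IsPointDerivation (W.aug r) (W.lin r i) := by
  intro a b
  simp only [lin_apply, aug_apply, MulMemClass.coe_mul, coeff_single_mul,
    Finset.Nat.antidiagonal_succ]
  simp

theorem aug_gen (i : Fin n) : W.aug r (W.gen r i) = 0 :=
  X_mem_orderGE (q := q) i 0 (by simp)

theorem lin_gen (i j : Fin n) : W.lin r i (W.gen r j) = if i = j then 1 else 0 := by
  rw [lin_apply, coe_gen, X, coeff_monomial]
  simp [Finsupp.single_left_inj]

variable {W} {W' : Weight q n}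

/-- The linear parts of mutually inverse isomorphisms preserving the augmentations are mutually
inverse matrices. -/
theorem sum_lin_mul_lin (hr : 0 < r) (φ : W.algebra r →ₐ[ℂ] W'.algebra r)
    (ψ : W'.algebra r →ₐ[ℂ] W.algebra r) (hφ : Continuous φ) (hψ : Continuous ψ)
    (hψφ : ∀ a, ψ (φ a) = a) (hφψ : ∀ b, φ (ψ b) = b)
    (h0 : ∀ i, W'.aug r (φ (W.gen r i)) = 0) (i k : Fin n) :
    ∑ a, W'.lin r a (φ (W.gen r k)) * W.lin r i (ψ (W'.gen r a)) = if i = k then 1 else 0 := by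
  have hχ : (W'.aug r).comp φ = W.aug r :=
    W.char_ext _ _ ((W'.continuous_aug hr).comp hφ) (W.continuous_aug hr)
      fun i => by simp [h0, aug_gen]
  have hχ' : (W.aug r).comp ψ = W'.aug r := by
    rw [← hχ]; ext b; simp [hφψ]
  -- The functional "coefficient of x_i after ψ" is a derivation at the constant-term character,
  -- hence a combination of the coordinate derivations. Evaluating this expansion at φ(x_k) gives
  -- the matrix identity.
  have hd := (W.isPointDerivation_lin (r := r) i).comp ψ
  rw [hχ'] at hd
  have he : W'.IsPointDerivation (W'.aug r)
      (∑ a, W.lin r i (ψ (W'.gen r a)) • W'.lin r a) :=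
    .sum _ fun a _ => (W'.isPointDerivation_lin a).smul _
  have h := hd.ext he ((W.continuous_lin hr i).comp hψ) (by
    rw [LinearMap.coe_sum, Finset.sum_fn]
    refine continuous_finsetSum _ fun a _ => ?_
    exact (W'.continuous_lin hr a).const_smul (W.lin r i (ψ (W'.gen r a)))) (by
    intro a
    simp [lin_gen])
  have := LinearMap.congr_fun h (φ (W.gen r k))
  simp only [LinearMap.comp_apply, AlgHom.toLinearMap_apply, hψφ, lin_gen, LinearMap.sum_apply,
    LinearMap.smul_apply, smul_eq_mul] at this
  rw [this]
  exact Finset.sum_congr rfl fun a _ => mul_comm _ _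

/-- Compares tangent spaces. Away from the constant-term character at most one generator carries a
nonzero derivative, whereas the derivations pulled back along φ contain at least two independent
ones, because φ has the right inverse ψ. -/
theorem aug_map_gen_eq_zero (hq : (q : ℂ) ≠ 1) (hn : 2 ≤ n) (hr : 0 < r)
    (φ : W.algebra r →ₐ[ℂ] W'.algebra r)
    (ψ : W'.algebra r →ₐ[ℂ] W.algebra r) (hφ : Continuous φ)
    (hφψ : ∀ b, φ (ψ b) = b) (l : Fin n) : W'.aug r (φ (W.gen r l)) = 0 := by
  by_contra hl
  set χ := (W'.aug r).comp φ with hχ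
  -- Applying χ and d to x_i x_j = q x_j x_i and cancelling 1 - q gives the vanishing of
  -- χ(x_i)χ(x_j) and of its derivative.
  have hrel : ∀ d : W.algebra r →ₗ[ℂ] ℂ, W.IsPointDerivation χ d → ∀ i, i ≠ l →
      d (W.gen r i) = 0 := by
    intro d hd i hi
    have hq' : (1 - (q : ℂ)) ≠ 0 := sub_ne_zero.2 hq.symm
    have key : ∀ i j, i < j → χ (W.gen r i) * χ (W.gen r j) = 0 ∧
        χ (W.gen r i) * d (W.gen r j) + d (W.gen r i) * χ (W.gen r j) = 0 := by
      intro i j hij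
      have e := W.gen_mul_gen (r := r) hij
      have e1 := congrArg χ e
      have e2 := congrArg d e
      rw [map_smul, map_mul, map_mul, smul_eq_mul] at e1
      rw [map_smul, hd, hd, smul_eq_mul] at e2
      constructor
      · apply mul_left_cancel₀ hq'
        linear_combination e1
      · apply mul_left_cancel₀ hq'
        linear_combination e2
    have hl' : χ (W.gen r l) ≠ 0 := hl
    rcases lt_or_gt_of_ne hi with h | h
    · obtain ⟨h1, h2⟩ := key _ _ h
      have h3 : χ (W.gen r i) = 0 := (mul_eq_zero.1 h1).resolve_right hl'
      rw [h3, zero_mul, zero_add] at h2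
      exact (mul_eq_zero.1 h2).resolve_right hl'
    · obtain ⟨h1, h2⟩ := key _ _ h
      have h3 : χ (W.gen r i) = 0 := (mul_eq_zero.1 h1).resolve_left hl'
      rw [h3, mul_zero, add_zero] at h2
      exact (mul_eq_zero.1 h2).resolve_left hl'
  have hD : ∀ a, W.IsPointDerivation χ ((W'.lin r a).comp φ.toLinearMap) := fun a =>
    (W'.isPointDerivation_lin a).comp φ
  have hc : ∀ a, Continuous ((W'.lin r a).comp φ.toLinearMap) := fun a =>
    (W'.continuous_lin hr a).comp hφ
  let i₀ : Fin n := ⟨0, by omega⟩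
  let i₁ : Fin n := ⟨1, by omega⟩
  have h01 : i₀ ≠ i₁ := by simp [i₀, i₁]
  set x := W'.lin r i₀ (φ (W.gen r l)) with hx
  set y := W'.lin r i₁ (φ (W.gen r l)) with hy
  -- Both combinations vanish on the generators other than x_l and take the value xy on x_l, so they
  -- coincide. Evaluating at ψ(y_{i₁}) gives x = 0, so the derivation for i₀ vanishes altogether,
  -- although it is 1 at ψ(y_{i₀}).
  have h := ((hD i₀).smul y).ext ((hD i₁).smul x) ((hc i₀).const_smul y) ((hc i₁).const_smul x)
    (fun i => by
      by_cases hi : i = l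
      · subst hi
        simp [← hx, ← hy, mul_comm]
      · simp [hrel _ ((hD i₀).smul y) i hi, hrel _ ((hD i₁).smul x) i hi])
  have hx0 : x = 0 := by
    have := LinearMap.congr_fun h (ψ (W'.gen r i₁))
    simpa [hφψ, lin_gen, h01] using this.symm
  have h' := (hD i₀).ext (d' := 0) (fun a b => by simp) (hc i₀) continuous_zero (fun i => by
      by_cases hi : i = l
      · subst hi
        simp [← hx, hx0]
      · rw [hrel _ (hD i₀) i hi]; simp)
  have := LinearMap.congr_fun h' (ψ (W'.gen r i₀))
  simp [hφψ, lin_gen] at this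

end Weight

/-! ### The two weights for |q| = 1 -/

theorem qFactorial_one (m : ℕ) : qFactorial 1 m = m.factorial := by
  induction m with
  | zero => simp [qFactorial]
  | succ m ih =>
    rw [qFactorial_succ, ih, Nat.factorial_succ]
    simp [qNumber]
    ring

theorem polydiskWeight_apply (hq : ‖(q : ℂ)‖ = 1) (k : Fin n →₀ ℕ) :
    (polydiskWeight q n).toFun k = 1 := by
  simp [polydiskWeight, polydiskWeightFun, hq]

theorem ballWeight_apply (hq : ‖(q : ℂ)‖ = 1) (k : Fin n →₀ ℕ) :
    (ballWeight q n).toFun k = √((∏ i, ((k i).factorial : ℝ)) / (k.degree.factorial : ℝ)) := by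
  simp [ballWeight, ballWeightFun, hq, qMultiFactorial, qFactorial_one]

theorem ballWeight_single (hq : ‖(q : ℂ)‖ = 1) (i : Fin n) (m : ℕ) :
    (ballWeight q n).toFun (Finsupp.single i m) = 1 := by
  rw [ballWeight_apply hq, Finset.prod_eq_single i]
  · simp [Nat.factorial_ne_zero]
  · intro j _ hj
    simp [hj]
  · simp

theorem two_pow_le_centralBinom (m : ℕ) : 2 ^ m ≤ m.centralBinom := by
  induction m with
  | zero => simp
  | succ m ih =>
    have h := Nat.succ_mul_centralBinom_succ m
    have h2 : (m + 1) * 2 ^ (m + 1) ≤ (m + 1) * (m + 1).centralBinom := by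
      rw [h, pow_succ]
      nlinarith
    exact Nat.le_of_mul_le_mul_left h2 (Nat.succ_pos m)

/-- The square of this weight is the reciprocal of the central binomial coefficient, which is at
least 2^m. -/
theorem ballWeight_pair_le (hq : ‖(q : ℂ)‖ = 1) {i j : Fin n} (hij : i ≠ j) (m : ℕ) :
    (ballWeight q n).toFun (Finsupp.single i m + Finsupp.single j m) ≤ ((√2)⁻¹) ^ m := by
  have h1 : ∏ l, (((Finsupp.single i m + Finsupp.single j m : Fin n →₀ ℕ) l).factorial : ℝ)
      = (m.factorial : ℝ) * m.factorial := by
    rw [← Finset.prod_subset (Finset.subset_univ {i, j}), Finset.prod_pair hij]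
    · simp [hij, hij.symm]
    · intro l _ hl
      simp only [Finset.mem_insert, Finset.mem_singleton, not_or] at hl
      simp [hl.1, hl.2]
  have h2 : (Finsupp.single i m + Finsupp.single j m : Fin n →₀ ℕ).degree = m + m := by
    simp
  rw [ballWeight_apply hq, h1, h2]
  have h3 : (((√2)⁻¹) ^ m) = √((2 ^ m)⁻¹) := by
    rw [Real.sqrt_inv, inv_pow, Real.sqrt_eq_rpow, Real.sqrt_eq_rpow, ← Real.rpow_natCast,
      ← Real.rpow_natCast, ← Real.rpow_mul (by norm_num), ← Real.rpow_mul (by norm_num), mul_comm]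
  rw [h3]
  apply Real.sqrt_le_sqrt
  rw [div_le_iff₀ (by positivity), inv_mul_eq_div, le_div_iff₀ (by positivity)]
  have h4 := Nat.add_choose_mul_factorial_mul_factorial m m
  have h5 : (2 : ℝ) ^ m ≤ ((m + m).choose m : ℕ) := by
    have := two_pow_le_centralBinom m
    rw [Nat.centralBinom, two_mul] at this
    exact_mod_cast this
  rw [← h4]
  push_cast
  nlinarith [mul_le_mul_of_nonneg_right h5
    (by positivity : (0 : ℝ) ≤ (m.factorial : ℝ) * m.factorial)]

/-! ### The case q ≠ 1 -/

/-- For `|q| = 1`, `q ≠ 1` there is no isomorphism between the algebras of a weight which is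
identically `1` and of a weight which is `1` on powers of the generators but decays exponentially
on products of equal powers of two different generators. -/
theorem Weight.not_iso_of_ne_one {r : ℝ} (hq : ‖(q : ℂ)‖ = 1) (hq1 : (q : ℂ) ≠ 1) (hn : 2 ≤ n)
    (hr : 0 < r) {A B : Weight q n} (hA : ∀ k, A.toFun k = 1)
    (hB : ∀ i m, B.toFun (Finsupp.single i m) = 1)
    (hB' : ∀ i j, i ≠ j → ∀ m,
      B.toFun (Finsupp.single i m + Finsupp.single j m) ≤ ((√2)⁻¹) ^ m)
    (φ : A.algebra r →ₐ[ℂ] B.algebra r) (ψ : B.algebra r →ₐ[ℂ] A.algebra r)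
    (hφ : Continuous φ) (hψ : Continuous ψ)
    (hψφ : ∀ a, ψ (φ a) = a) (hφψ : ∀ b, φ (ψ b) = b) : False := by
  have h0 : ∀ i, B.aug r (φ (A.gen r i)) = 0 :=
    Weight.aug_map_gen_eq_zero hq1 hn hr φ ψ hφ hφψ
  have h0' : ∀ i, A.aug r (ψ (B.gen r i)) = 0 :=
    Weight.aug_map_gen_eq_zero hq1 hn hr ψ φ hψ hψφ
  have hLM := Weight.sum_lin_mul_lin hr φ ψ hφ hψ hψφ hφψ h0
  set L : Fin n → Fin n → ℂ := fun i a => B.lin r a (φ (A.gen r i)) with hL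
  set M : Fin n → Fin n → ℂ := fun a i => A.lin r i (ψ (B.gen r a)) with hM
  have hLM' : ∀ i k, ∑ a, L k a * M a i = if i = k then 1 else 0 := hLM
  have hdisj' : ∀ i j, i < j → ∀ a, L i a * L j a = 0 := by
    intro i j hij a
    have e := congrArg φ (A.gen_mul_gen (r := r) hij)
    rw [map_smul, map_mul, map_mul] at e
    -- With zero constant terms, the coefficient of x_a^2 in a product is the product of the
    -- coefficients of x_a, so the relation reads (1 - q) L_{ia} L_{ja} = 0.
    have e' := congrArg (fun b : B.algebra r => coeff (Finsupp.single a 2) (b : QSeries q n)) e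
    have hi := h0 i
    have hj := h0 j
    rw [Weight.aug_apply] at hi hj
    simp only [MulMemClass.coe_mul, Subalgebra.coe_smul, map_smul, coeff_single_mul,
      Finset.Nat.antidiagonal_succ] at e'
    simp [hi, hj] at e'
    apply mul_left_cancel₀ (sub_ne_zero.2 hq1.symm)
    simp only [hL, Weight.lin_apply]
    linear_combination e'
  have hdisj : ∀ i j, i ≠ j → ∀ a, L i a * L j a = 0 := by
    intro i j hij a
    rcases lt_or_gt_of_ne hij with h | h
    · exact hdisj' i j h a
    · rw [mul_comm]; exact hdisj' j i h a
  have hex : ∀ i, ∃ a, L i a ≠ 0 := by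
    intro i
    by_contra! h
    have := hLM' i i
    simp [h] at this
  choose t ht using hex
  have htinj : Function.Injective t := by
    intro i j hij
    by_contra hne
    rcases mul_eq_zero.1 (hdisj i j hne (t i)) with h | h
    · exact ht i h
    · rw [hij] at h; exact ht j h
  -- Rows have disjoint supports and none is zero; counting makes t a permutation, so each row has
  -- only one nonzero entry.
  have htsurj : Function.Surjective t := Finite.surjective_of_injective htinj
  have hLzero : ∀ i a, a ≠ t i → L i a = 0 := by
    intro i a ha
    obtain ⟨j, rfl⟩ := htsurj a
    have hji : i ≠ j := fun h => ha (h ▸ rfl)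
    exact (mul_eq_zero.1 (hdisj i j hji (t j))).resolve_right (ht j)
  have hML : ∀ i k, L k (t k) * M (t k) i = if i = k then 1 else 0 := by
    intro i k
    rw [← hLM' i k, Finset.sum_eq_single (t k)]
    · intro a _ ha
      rw [hLzero k a ha, zero_mul]
    · simp
  have hMv : ∀ i k, M (t k) i = if i = k then (L k (t k))⁻¹ else 0 := by
    intro i k
    have := hML i k
    split_ifs at this ⊢ with h
    · exact eq_inv_of_mul_eq_one_right this
    · exact (mul_eq_zero.1 this).resolve_left (ht k)
  have hlead : ∀ i, ((φ (A.gen r i) : B.algebra r) : QSeries q n) - L i (t i) • X (t i)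
      ∈ orderGE q n 2 := by
    intro i
    refine mem_orderGE_two ?_ fun a => ?_
    · rw [map_sub, map_smul, X_mem_orderGE (q := q) (t i) 0 (by simp), smul_zero, sub_zero]
      exact h0 i
    · rw [map_sub, map_smul]
      have e := B.lin_gen (r := r) a (t i)
      rw [Weight.lin_apply, Weight.coe_gen] at e
      rw [e]
      change L i a - _ = 0
      split_ifs with h
      · simp [h]
      · simp [hLzero i a h]
  have hlead' : ∀ i, ((ψ (B.gen r (t i)) : A.algebra r) : QSeries q n) - (L i (t i))⁻¹ • X i
      ∈ orderGE q n 2 := by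
    intro i
    refine mem_orderGE_two ?_ fun a => ?_
    · rw [map_sub, map_smul, X_mem_orderGE (q := q) i 0 (by simp), smul_zero, sub_zero]
      exact h0' (t i)
    · rw [map_sub, map_smul]
      have e := A.lin_gen (r := r) a i
      rw [Weight.lin_apply, Weight.coe_gen] at e
      rw [e]
      change M (t i) a - _ = 0
      rw [hMv]
      split_ifs with h
      · simp
      · simp
  have hXpow : ∀ (i : Fin n) (m : ℕ), (X i : QSeries q n) ^ m = monomial (Finsupp.single i m) 1 := by
    intro i m
    exact congrArg Subtype.val (A.gen_pow (r := r) i m)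
  have hLle : ∀ i, ‖L i (t i)‖ ≤ 1 := by
    intro i
    by_contra! hlt
    have hc0 : 0 < ‖L i (t i)‖ := by linarith
    -- At this radius the leading term of φ(x_i)^m has norm exactly r^m, while continuity bounds it
    -- by C ρ'^m with ρ' < r.
    have hρ : r / ‖L i (t i)‖ ∈ Set.Ioo 0 r := ⟨by positivity, div_lt_self hr hlt⟩
    obtain ⟨ρ', C, hC, hle⟩ := A.exists_norm_map_le hr φ.toLinearMap hφ ⟨_, hρ⟩
    have hrρ : r ≤ ρ' := by
      refine le_of_pow_le_mul_pow (C := C) 0 ρ'.2.1.le fun m => ?_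
      have h1 := hle (A.gen r i ^ m)
      rw [A.gen_pow, Weight.norm_mono, hA, ← A.gen_pow] at h1
      have h2 := (B.term_le_norm ⟨_, hρ⟩ (φ (A.gen r i ^ m)) (Finsupp.single (t i) m)).trans h1
      have h3 := pow_sub_pow_mem_orderGE (mem_orderGE_one (h0 i))
        ((orderGE q n 1).smul_mem _ (X_mem_orderGE (t i))) (hlead i) m (Finsupp.single (t i) m)
        (by simp)
      rw [map_sub, sub_eq_zero, smul_pow, hXpow, map_smul, coeff_monomial, if_pos rfl,
        smul_eq_mul, mul_one] at h3
      rw [Weight.term, hB, map_pow, SubmonoidClass.coe_pow, h3] at h2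
      simpa [← mul_pow, mul_div_cancel₀ _ hc0.ne'] using h2
    exact absurd ρ'.2.2 (not_lt.2 hrρ)
  let i₀ : Fin n := ⟨0, by omega⟩
  let i₁ : Fin n := ⟨1, by omega⟩
  have h01 : i₀ ≠ i₁ := by simp [i₀, i₁]
  -- Any factor whose square exceeds 1/√2 would do: continuity will give ρ² ≤ ρ'²/√2 with ρ' < r,
  -- and 0.81 > 1/1.4 ≥ 1/√2.
  have hρ : 9 / 10 * r ∈ Set.Ioo 0 r := ⟨by positivity, by linarith⟩
  obtain ⟨ρ', C, hC, hle⟩ := B.exists_norm_map_le hr ψ.toLinearMap hψ ⟨_, hρ⟩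
  have hfin : (9 / 10 * r) ^ 2 ≤ (√2)⁻¹ * (ρ' : ℝ) ^ 2 := by
    have hρ0 := ρ'.2.1
    refine le_of_pow_le_mul_pow (C := C) 0 (by positivity) fun m => ?_
    have h1 := hle (B.gen r (t i₀) ^ m * B.gen r (t i₁) ^ m)
    have hmul : ∀ (W : Weight q n) (i j : Fin n), W.gen r i ^ m * W.gen r j ^ m
        = twist q (Finsupp.single i m) (Finsupp.single j m)
          • W.mono r (Finsupp.single i m + Finsupp.single j m) := by
      intro W i j
      rw [W.gen_pow, W.gen_pow]
      apply Subtype.ext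
      change (monomial _ 1 * monomial _ 1 : QSeries q n) = _ • monomial _ 1
      rw [monomial_mul_monomial]
      ext m
      simp [coeff_monomial]
    have htw : ∀ k l : Fin n →₀ ℕ, ‖twist q k l‖ = 1 := fun k l => by simp [norm_twist, hq]
    have h2 : B.norm r ρ' (B.gen r (t i₀) ^ m * B.gen r (t i₁) ^ m)
        ≤ ((√2)⁻¹) ^ m * (ρ' : ℝ) ^ (m + m) := by
      rw [hmul, map_smul_eq_mul, htw, one_mul, Weight.norm_mono]
      have hdeg : (Finsupp.single (t i₀) m + Finsupp.single (t i₁) m : Fin n →₀ ℕ).degree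
          = m + m := by simp
      rw [hdeg]
      exact mul_le_mul_of_nonneg_right (hB' _ _ (htinj.ne h01) m) (by positivity)
    have h3 := (A.term_le_norm ⟨_, hρ⟩ (ψ (B.gen r (t i₀) ^ m * B.gen r (t i₁) ^ m))
      (Finsupp.single i₀ m + Finsupp.single i₁ m)).trans
        (h1.trans (mul_le_mul_of_nonneg_left h2 hC.le))
    have h4 := mul_sub_mul_mem_orderGE
      (pow_mem_orderGE ((orderGE q n 1).smul_mem _ (X_mem_orderGE i₀)) m)
      (pow_mem_orderGE (mem_orderGE_one (h0' (t i₁))) m)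
      (pow_sub_pow_mem_orderGE (mem_orderGE_one (h0' (t i₀)))
        ((orderGE q n 1).smul_mem _ (X_mem_orderGE i₀)) (hlead' i₀) m)
      (pow_sub_pow_mem_orderGE (mem_orderGE_one (h0' (t i₁)))
        ((orderGE q n 1).smul_mem _ (X_mem_orderGE i₁)) (hlead' i₁) m)
      (Finsupp.single i₀ m + Finsupp.single i₁ m) (by simp)
    rw [map_sub, sub_eq_zero, smul_pow, smul_pow, hXpow, hXpow, smul_mul_smul_comm, map_smul,
      monomial_mul_monomial, coeff_monomial, if_pos rfl] at h4
    -- The leading coefficient is a product of m-th powers of inverses of entries of modulus at most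
    -- 1; the twist has modulus 1.
    have h5 : 1 ≤ ‖coeff (Finsupp.single i₀ m + Finsupp.single i₁ m)
        ((ψ (B.gen r (t i₀) ^ m * B.gen r (t i₁) ^ m) : A.algebra r) : QSeries q n)‖ := by
      rw [map_mul, map_pow, map_pow, MulMemClass.coe_mul, SubmonoidClass.coe_pow,
        SubmonoidClass.coe_pow, h4]
      simp only [norm_smul, norm_mul, norm_pow, norm_inv, htw, mul_one]
      have hinv : ∀ i, 1 ≤ ‖L i (t i)‖⁻¹ := fun i =>
        (one_le_inv₀ (norm_pos_iff.2 (ht i))).2 (hLle i)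
      exact one_le_mul_of_one_le_of_one_le (one_le_pow₀ (hinv _)) (one_le_pow₀ (hinv _))
    have hdeg : (Finsupp.single i₀ m + Finsupp.single i₁ m : Fin n →₀ ℕ).degree = m + m := by
      simp
    rw [Weight.term, hA, mul_one, hdeg] at h3
    calc ((9 / 10 * r) ^ 2) ^ m = 1 * (9 / 10 * r) ^ (m + m) := by
          rw [one_mul, ← pow_mul, two_mul]
      _ ≤ _ := mul_le_mul_of_nonneg_right h5 (by positivity)
      _ ≤ _ := h3
      _ = _ := by ring
  have hs : (1.4 : ℝ) ≤ √2 := Real.le_sqrt_of_sq_le (by norm_num)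
  have hs' : (√2)⁻¹ ≤ (1.4 : ℝ)⁻¹ := inv_anti₀ (by norm_num) hs
  have hρ' : (ρ' : ℝ) ^ 2 ≤ r ^ 2 := pow_le_pow_left₀ ρ'.2.1.le ρ'.2.2.le 2
  have : (√2)⁻¹ * (ρ' : ℝ) ^ 2 ≤ (1.4 : ℝ)⁻¹ * r ^ 2 := by gcongr
  have hr2 : 0 < r ^ 2 := by positivity
  norm_num at this
  nlinarith

/-! ### The Schwarz–Pick inequality -/

/-- The automorphism of the disc of radius `r` which maps `0` to `p`. -/
def mobius (r : ℝ) (p s : ℂ) : ℂ := (r : ℂ) ^ 2 * (s + p) / ((r : ℂ) ^ 2 + starRingEnd ℂ p * s)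

/-- Positivity of the right-hand side inside the disc yields both the nonvanishing of the
denominator and the fact that the disc is mapped into itself. -/
theorem sq_norm_mobius_identity (r : ℝ) (p s : ℂ) :
    ‖(r : ℂ) ^ 2 + starRingEnd ℂ p * s‖ ^ 2 - r ^ 2 * ‖s + p‖ ^ 2
      = (r ^ 2 - ‖p‖ ^ 2) * (r ^ 2 - ‖s‖ ^ 2) := by
  simp only [Complex.sq_norm, Complex.normSq_apply]
  simp only [Complex.add_re, Complex.add_im,
    Complex.mul_re, Complex.mul_im, Complex.conj_re, Complex.conj_im, pow_two, Complex.ofReal_re,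
    Complex.ofReal_im]
  ring

section

variable {r : ℝ} {p s : ℂ}

theorem mobius_aux (hp : ‖p‖ < r) (hs : ‖s‖ < r) :
    0 < (r ^ 2 - ‖p‖ ^ 2) * (r ^ 2 - ‖s‖ ^ 2) :=
  mul_pos (sub_pos.2 (pow_lt_pow_left₀ hp (norm_nonneg _) two_ne_zero))
    (sub_pos.2 (pow_lt_pow_left₀ hs (norm_nonneg _) two_ne_zero))

theorem mobius_denom_ne_zero (hp : ‖p‖ < r) (hs : ‖s‖ < r) :
    (r : ℂ) ^ 2 + starRingEnd ℂ p * s ≠ 0 := by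
  intro h
  have h1 := sq_norm_mobius_identity r p s
  have h2 := mobius_aux hp hs
  rw [h, norm_zero] at h1
  nlinarith [mul_nonneg (sq_nonneg r) (sq_nonneg ‖s + p‖)]

theorem norm_mobius_lt (hr : 0 < r) (hp : ‖p‖ < r) (hs : ‖s‖ < r) : ‖mobius r p s‖ < r := by
  have h0 := norm_pos_iff.2 (mobius_denom_ne_zero hp hs)
  rw [mobius, norm_div, norm_mul, norm_pow, Complex.norm_real, Real.norm_of_nonneg hr.le,
    div_lt_iff₀ h0, pow_two, mul_assoc]
  refine mul_lt_mul_of_pos_left ?_ hr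
  refine lt_of_pow_lt_pow_left₀ 2 h0.le ?_
  have h1 := sq_norm_mobius_identity r p s
  have h2 := mobius_aux hp hs
  rw [mul_pow]
  linarith

theorem hasDerivAt_mobius (hp : ‖p‖ < r) (hs : ‖s‖ < r) :
    HasDerivAt (mobius r p) ((r : ℂ) ^ 2 * ((r : ℂ) ^ 2 - starRingEnd ℂ p * p)
      / ((r : ℂ) ^ 2 + starRingEnd ℂ p * s) ^ 2) s := by
  have h1 : HasDerivAt (fun s => (r : ℂ) ^ 2 * (s + p)) ((r : ℂ) ^ 2 * 1) s :=
    ((hasDerivAt_id s).add_const p).const_mul _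
  have h2 : HasDerivAt (fun s => (r : ℂ) ^ 2 + starRingEnd ℂ p * s) (starRingEnd ℂ p * 1) s :=
    ((hasDerivAt_id s).const_mul _).const_add _
  exact (h1.fun_div h2 (mobius_denom_ne_zero hp hs)).congr_deriv (by ring)

theorem mobius_zero (hr : 0 < r) : mobius r p 0 = p := by
  have : (r : ℂ) ≠ 0 := by exact_mod_cast hr.ne'
  simp [mobius]
  field_simp

theorem conj_mul_self_eq (p : ℂ) : starRingEnd ℂ p * p = ((‖p‖ ^ 2 : ℝ) : ℂ) := by
  rw [mul_comm, Complex.mul_conj, Complex.normSq_eq_norm_sq]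

/-- The Schwarz–Pick inequality at the centre of a disc. -/
theorem norm_deriv_le_of_mapsTo_disc {R : ℝ} (hr : 0 < r) (hR : 0 < R) {F : ℂ → ℂ}
    (hF : DifferentiableOn ℂ F (ball 0 R)) (hmaps : ∀ ζ, ‖ζ‖ < R → ‖F ζ‖ < r) :
    ‖deriv F 0‖ ≤ (r ^ 2 - ‖F 0‖ ^ 2) / r ^ 2 * (r / R) := by
  have hp : ‖F 0‖ < r := hmaps 0 (by simpa using hR)
  have hp' : ‖-F 0‖ < r := by rwa [norm_neg]
  have hδ : 0 < r ^ 2 - ‖F 0‖ ^ 2 := sub_pos.2 (pow_lt_pow_left₀ hp (norm_nonneg _) two_ne_zero)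
  -- Moving F(0) to 0 by an automorphism of the target disc reduces the claim to the Schwarz lemma.
  -- The derivative of that automorphism at F(0) is r²/(r² - |F(0)|²).
  have hd : DifferentiableOn ℂ (fun ζ => mobius r (-F 0) (F ζ)) (ball 0 R) := by
    intro ζ hζ
    have hζ' : ‖ζ‖ < R := by simpa using hζ
    exact (hasDerivAt_mobius hp' (hmaps ζ hζ')).differentiableAt.comp_differentiableWithinAt ζ
      (hF ζ hζ)
  have h0 : mobius r (-F 0) (F 0) = 0 := by simp [mobius]
  have hS := Complex.norm_deriv_le_div_of_mapsTo_ball (R₂ := r) hd (fun ζ hζ => by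
    have hζ' : ‖ζ‖ < R := by simpa using hζ
    simpa [h0] using (norm_mobius_lt hr hp' (hmaps ζ hζ')).le) hR
  have hFd : HasDerivAt F (deriv F 0) 0 :=
    (hF.differentiableAt (ball_mem_nhds 0 hR)).hasDerivAt
  have hcomp := ((hasDerivAt_mobius hp' hp).comp 0 hFd).deriv
  have e : deriv (fun ζ => mobius r (-F 0) (F ζ)) 0
      = ((r ^ 2 / (r ^ 2 - ‖F 0‖ ^ 2) : ℝ) : ℂ) * deriv F 0 := by
    refine hcomp.trans ?_
    congr 1
    have h1 : starRingEnd ℂ (-F 0) * (-F 0) = ((‖F 0‖ ^ 2 : ℝ) : ℂ) := by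
      rw [conj_mul_self_eq, norm_neg]
    have h2 : starRingEnd ℂ (-F 0) * F 0 = -((‖F 0‖ ^ 2 : ℝ) : ℂ) := by
      rw [← h1]; ring
    have h3 : ((r ^ 2 - ‖F 0‖ ^ 2 : ℝ) : ℂ) ≠ 0 := by exact_mod_cast hδ.ne'
    rw [h1, h2]
    push_cast at h3 ⊢
    rw [← sub_eq_add_neg]
    field_simp
  rw [e, norm_mul, Complex.norm_real, Real.norm_of_nonneg (by positivity)] at hS
  rw [div_mul_eq_mul_div, le_div_iff₀ (by positivity)]
  rw [div_mul_eq_mul_div, div_le_iff₀ hδ] at hS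
  linarith

end

/-! ### Evaluation at points -/

namespace Weight

variable (W : Weight q n) {r : ℝ}

/-- The value `∑_k c_k z^k` of a series at a point. -/
def evalFun (z : Fin n → ℂ) (a : QSeries q n) : ℂ := ∑' k, coeff k a * ∏ i, z i ^ k i

/-- All monomials take at the point `z` values bounded by their `‖·‖_ρ`-norms. -/
def Dominates (ρ : ℝ) (z : Fin n → ℂ) : Prop :=
  ∀ k : Fin n →₀ ℕ, ‖∏ i, z i ^ k i‖ ≤ W.toFun k * ρ ^ k.degree

variable {W} {z : Fin n → ℂ}

theorem Dominates.norm_le {ρ : ℝ} (hz : W.Dominates ρ z) (a : QSeries q n) (k : Fin n →₀ ℕ) :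
    ‖coeff k a * ∏ i, z i ^ k i‖ ≤ W.term ρ a k := by
  rw [norm_mul, term, mul_assoc]
  exact mul_le_mul_of_nonneg_left (hz k) (norm_nonneg _)

theorem Dominates.summable {ρ : Set.Ioo (0 : ℝ) r} (hz : W.Dominates ρ z) (a : W.algebra r) :
    Summable fun k => ‖coeff k (a : QSeries q n) * ∏ i, z i ^ k i‖ :=
  Summable.of_nonneg_of_le (fun _ => norm_nonneg _) (hz.norm_le a) (a.2 ρ ρ.2)

theorem Dominates.norm_evalFun_le {ρ : Set.Ioo (0 : ℝ) r} (hz : W.Dominates ρ z)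
    (a : W.algebra r) : ‖evalFun z (a : QSeries q n)‖ ≤ W.norm r ρ a :=
  (norm_tsum_le_tsum_norm (hz.summable a)).trans
    ((hz.summable a).tsum_le_tsum (hz.norm_le a) (a.2 ρ ρ.2))

theorem evalFun_monomial (k : Fin n →₀ ℕ) :
    evalFun z (monomial k 1 : QSeries q n) = ∏ i, z i ^ k i := by
  rw [evalFun, tsum_eq_single k]
  · simp [coeff_monomial]
  · intro l hl
    simp [coeff_monomial, hl]

theorem evalFun_gen (i : Fin n) : evalFun z (W.gen r i : QSeries q n) = z i := by
  rw [coe_gen, X, evalFun_monomial, Finset.prod_eq_single i]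
  · simp
  · intro j _ hj
    simp [hj]
  · simp

theorem evalFun_zero (a : QSeries q n) : evalFun 0 a = coeff 0 a := by
  rw [evalFun, tsum_eq_single 0]
  · simp
  · intro k hk
    obtain ⟨i, hi⟩ := DFunLike.ne_iff.1 hk
    rw [Finset.prod_eq_zero (Finset.mem_univ i), mul_zero]
    simpa using hi

theorem twist_eq_one (hq : (q : ℂ) = 1) (k l : Fin n →₀ ℕ) : twist q k l = 1 := by
  simp [twist, hq]

/-- Domination gives absolute convergence, so the Cauchy product may be rearranged; for q = 1 it is
the untwisted product. -/
theorem Dominates.evalFun_mul {ρ : Set.Ioo (0 : ℝ) r} (hq : (q : ℂ) = 1) (hz : W.Dominates ρ z)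
    (a b : W.algebra r) :
    evalFun z ((a : QSeries q n) * (b : QSeries q n))
      = evalFun z (a : QSeries q n) * evalFun z (b : QSeries q n) := by
  have hs := summable_mul_of_summable_norm (hz.summable a) (hz.summable b)
  unfold evalFun
  rw [(hz.summable a).of_norm.tsum_mul_tsum_eq_tsum_sum_antidiagonal (hz.summable b).of_norm hs]
  refine tsum_congr fun k => ?_
  rw [coeff_mul, Finset.sum_mul]
  refine Finset.sum_congr rfl fun p hp => ?_
  rw [Finset.HasAntidiagonal.mem_antidiagonal] at hp
  rw [twist_eq_one hq, ← hp]
  simp only [Finsupp.add_apply, pow_add, Finset.prod_mul_distrib]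
  ring

/-- Evaluation at a point, as a character, in the commutative case. -/
def Dominates.eval {ρ : Set.Ioo (0 : ℝ) r} (hq : (q : ℂ) = 1) (hz : W.Dominates ρ z) :
    W.algebra r →ₐ[ℂ] ℂ :=
  AlgHom.ofLinearMap
    { toFun := fun a => evalFun z (a : QSeries q n)
      map_add' := fun a b => by
        simp only [evalFun, AddMemClass.coe_add, map_add, add_mul]
        exact (hz.summable a).of_norm.tsum_add (hz.summable b).of_norm
      map_smul' := fun c a => by
        simp only [evalFun, Subalgebra.coe_smul, map_smul, smul_eq_mul, mul_assoc, RingHom.id_apply]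
        exact tsum_mul_left }
    (by
      change evalFun z (monomial 0 1 : QSeries q n) = 1
      simp [evalFun_monomial])
    (fun a b => hz.evalFun_mul hq a b)

theorem Dominates.eval_apply {ρ : Set.Ioo (0 : ℝ) r} (hq : (q : ℂ) = 1) (hz : W.Dominates ρ z)
    (a : W.algebra r) : hz.eval hq a = evalFun z (a : QSeries q n) := rfl

theorem Dominates.continuous_eval {ρ : Set.Ioo (0 : ℝ) r} (hq : (q : ℂ) = 1)
    (hz : W.Dominates ρ z) : Continuous (hz.eval hq) :=
  W.continuous_of_norm_le (hz.eval hq).toLinearMap ρ zero_le_one fun a => by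
    rw [one_mul]; exact hz.norm_evalFun_le a

theorem char_mono (hq : (q : ℂ) = 1) (χ : W.algebra r →ₐ[ℂ] ℂ) (k : Fin n →₀ ℕ) :
    χ (W.mono r k) = ∏ i, χ (W.gen r i) ^ k i := by
  induction k using Finsupp.induction with
  | zero => simp [mono_zero]
  | single_add i m k hi hm ih =>
    have h : W.gen r i ^ m * W.mono r k = W.mono r (Finsupp.single i m + k) := by
      rw [gen_pow]
      apply Subtype.ext
      change (monomial _ 1 * monomial _ 1 : QSeries q n) = monomial _ 1
      rw [monomial_mul_monomial, twist_eq_one hq, one_mul, one_mul]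
    rw [← h, map_mul, ih, map_pow]
    simp only [Finsupp.add_apply, pow_add, Finset.prod_mul_distrib]
    congr 1
    rw [Finset.prod_eq_single i]
    · simp
    · intro j _ hj
      simp [hj]
    · simp

/-- Continuity on monomials alone; this growth bound locates the point of a character in the open
polydisk or ball. -/
theorem exists_norm_char_le (hq : (q : ℂ) = 1) (hr : 0 < r) (χ : W.algebra r →ₐ[ℂ] ℂ)
    (hχ : Continuous χ) : ∃ ρ : Set.Ioo (0 : ℝ) r, ∃ C : ℝ, 0 < C ∧ ∀ k : Fin n →₀ ℕ,
      ‖∏ i, χ (W.gen r i) ^ k i‖ ≤ C * (W.toFun k * (ρ : ℝ) ^ k.degree) := by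
  obtain ⟨ρ, C, hC, h⟩ := W.exists_le_norm_of_continuous hr
    ((normSeminorm ℂ ℂ).comp χ.toLinearMap) (continuous_norm.comp hχ)
  refine ⟨ρ, C, hC, fun k => ?_⟩
  have := h (W.mono r k)
  rw [norm_mono] at this
  rw [← char_mono hq]
  exact this

/-! ### Derivatives along analytic discs -/

/-- An analytic disc of radius `R` inside the spectrum of the algebra. -/
structure IsDisc (W : Weight q n) (r R : ℝ) (γ : ℂ → Fin n → ℂ) : Prop where
  radius_pos : 0 < R
  differentiableOn : ∀ i, DifferentiableOn ℂ (fun ζ => γ ζ i) (ball 0 R)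
  dominates : ∀ s ∈ Set.Ioo 0 R, ∃ ρ : Set.Ioo (0 : ℝ) r, ∀ ζ, ‖ζ‖ ≤ s → W.Dominates ρ (γ ζ)

variable {R : ℝ} {γ : ℂ → Fin n → ℂ}

theorem IsDisc.exists_dominates (h : W.IsDisc r R γ) {ζ : ℂ} (hζ : ‖ζ‖ < R) :
    ∃ ρ : Set.Ioo (0 : ℝ) r, W.Dominates ρ (γ ζ) := by
  obtain ⟨s, hs, hs'⟩ := exists_between hζ
  obtain ⟨ρ, hρ⟩ := h.dominates s ⟨(norm_nonneg _).trans_lt hs, hs'⟩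
  exact ⟨ρ, hρ ζ hs.le⟩

/-- On each smaller disc a single radius ρ dominates, and the norm series of a at ρ is a Weierstrass
majorant. -/
theorem IsDisc.differentiableOn_evalFun (h : W.IsDisc r R γ) (a : W.algebra r) :
    DifferentiableOn ℂ (fun ζ => evalFun (γ ζ) (a : QSeries q n)) (ball 0 R) := by
  intro ζ hζ
  have hζ' : ‖ζ‖ < R := by simpa using hζ
  obtain ⟨s, hs, hs'⟩ := exists_between hζ'
  obtain ⟨ρ, hρ⟩ := h.dominates s ⟨(norm_nonneg _).trans_lt hs, hs'⟩
  have hd : DifferentiableOn ℂ (fun ζ => evalFun (γ ζ) (a : QSeries q n)) (ball 0 s) := by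
    refine Complex.differentiableOn_tsum_of_summable_norm (a.2 ρ ρ.2) (fun k => ?_) isOpen_ball
      fun k w hw => (hρ w (by simpa using (mem_ball_zero_iff.1 hw).le)).norm_le a k
    refine DifferentiableOn.const_mul (DifferentiableOn.fun_finsetProd fun i _ => ?_) _
    exact ((h.differentiableOn i).mono (ball_subset_ball hs'.le)).pow _
  exact (hd.differentiableAt
    (isOpen_ball.mem_nhds (by simpa using hs))).differentiableWithinAt

theorem IsDisc.differentiableAt_zero (h : W.IsDisc r R γ) (a : W.algebra r) :
    DifferentiableAt ℂ (fun ζ => evalFun (γ ζ) (a : QSeries q n)) 0 :=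
  (h.differentiableOn_evalFun a).differentiableAt (ball_mem_nhds 0 h.radius_pos)

theorem IsDisc.eventually_dominates (h : W.IsDisc r R γ) :
    ∀ᶠ ζ in 𝓝 (0 : ℂ), ∃ ρ : Set.Ioo (0 : ℝ) r, W.Dominates ρ (γ ζ) := by
  filter_upwards [ball_mem_nhds 0 h.radius_pos] with ζ hζ
  exact h.exists_dominates (by simpa using hζ)

/-- The derivative at the centre of an analytic disc. -/
def IsDisc.derivation (hq : (q : ℂ) = 1) (h : W.IsDisc r R γ) : W.algebra r →ₗ[ℂ] ℂ where
  toFun a := deriv (fun ζ => evalFun (γ ζ) (a : QSeries q n)) 0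
  map_add' a b := by
    rw [← deriv_fun_add (h.differentiableAt_zero a) (h.differentiableAt_zero b)]
    refine EventuallyEq.deriv_eq ?_
    filter_upwards [h.eventually_dominates] with ζ ⟨ρ, hρ⟩
    exact map_add (hρ.eval hq) a b
  map_smul' c a := by
    rw [RingHom.id_apply, smul_eq_mul, ← deriv_const_mul _ (h.differentiableAt_zero a)]
    refine EventuallyEq.deriv_eq ?_
    filter_upwards [h.eventually_dominates] with ζ ⟨ρ, hρ⟩
    exact map_smul (hρ.eval hq) c a

theorem IsDisc.derivation_apply (hq : (q : ℂ) = 1) (h : W.IsDisc r R γ) (a : W.algebra r) :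
    h.derivation hq a = deriv (fun ζ => evalFun (γ ζ) (a : QSeries q n)) 0 := rfl

theorem IsDisc.derivation_gen (hq : (q : ℂ) = 1) (h : W.IsDisc r R γ) (i : Fin n) :
    h.derivation hq (W.gen r i) = deriv (fun ζ => γ ζ i) 0 := by
  simp only [derivation_apply, evalFun_gen]

theorem IsDisc.isPointDerivation (hq : (q : ℂ) = 1) (h : W.IsDisc r R γ)
    (χ : W.algebra r →ₐ[ℂ] ℂ) (hχ : ∀ a, χ a = evalFun (γ 0) (a : QSeries q n)) :
    W.IsPointDerivation χ (h.derivation hq) := by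
  intro a b
  rw [hχ, hχ, h.derivation_apply, h.derivation_apply, h.derivation_apply, add_comm,
    ← deriv_fun_mul (h.differentiableAt_zero a) (h.differentiableAt_zero b)]
  refine EventuallyEq.deriv_eq ?_
  filter_upwards [h.eventually_dominates] with ζ ⟨ρ, hρ⟩
  exact map_mul (hρ.eval hq) a b

/-- Cauchy's estimate on the circle of radius R/2, where one norm bounds all evaluations. -/
theorem IsDisc.continuous_derivation (hq : (q : ℂ) = 1) (h : W.IsDisc r R γ) :
    Continuous (h.derivation hq) := by
  have hR := h.radius_pos
  have hs : R / 2 ∈ Set.Ioo 0 R := ⟨by linarith, by linarith⟩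
  obtain ⟨ρ, hρ⟩ := h.dominates _ hs
  refine W.continuous_of_norm_le _ ρ (C := (R / 2)⁻¹) (by positivity) fun a => ?_
  rw [inv_mul_eq_div]
  refine Complex.norm_deriv_le_of_forall_mem_sphere_norm_le hs.1 ?_ fun ζ hζ => ?_
  · exact ((h.differentiableOn_evalFun a).mono
      (closedBall_subset_ball hs.2)).diffContOnCl_ball subset_rfl
  · exact (hρ ζ (mem_sphere_zero_iff_norm.1 hζ).le).norm_evalFun_le a

end Weight

/-! ### Points of the polydisk and of the ball -/

theorem norm_one_of_eq_one (hq : (q : ℂ) = 1) : ‖(q : ℂ)‖ = 1 := by rw [hq, norm_one]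

theorem polydisk_dominates (hq : ‖(q : ℂ)‖ = 1) {ρ : ℝ} {z : Fin n → ℂ} (hz : ∀ i, ‖z i‖ ≤ ρ) :
    (polydiskWeight q n).Dominates ρ z := by
  intro k
  rw [polydiskWeight_apply hq, one_mul, norm_prod, Finsupp.degree_eq_sum,
    ← Finset.prod_pow_eq_pow_sum]
  refine Finset.prod_le_prod (fun i _ => norm_nonneg _) fun i _ => ?_
  rw [norm_pow]
  exact pow_le_pow_left₀ (norm_nonneg _) (hz i) _

/-- The powers x_i^m have norm ρ^m, so taking m-th roots gives the bound ρ, strictly less than r. -/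
theorem norm_char_polydisk_lt {r : ℝ} (hq : (q : ℂ) = 1) (hr : 0 < r)
    (χ : (polydiskWeight q n).algebra r →ₐ[ℂ] ℂ) (hχ : Continuous χ) (i : Fin n) :
    ‖χ ((polydiskWeight q n).gen r i)‖ < r := by
  obtain ⟨ρ, C, hC, h⟩ := Weight.exists_norm_char_le hq hr χ hχ
  refine lt_of_le_of_lt ?_ ρ.2.2
  refine le_of_pow_le_mul_pow (C := C) 0 ρ.2.1.le fun m => ?_
  have := h (Finsupp.single i m)
  rw [polydiskWeight_apply (norm_one_of_eq_one hq), Finset.prod_eq_single i] at this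
  · simpa using this
  · intro j _ hj
    simp [hj]
  · simp

theorem ballWeight_sq_mul_multinomial (hq : ‖(q : ℂ)‖ = 1) (k : Fin n →₀ ℕ) :
    (ballWeight q n).toFun k ^ 2 * (Nat.multinomial Finset.univ k : ℝ) = 1 := by
  have h := Nat.multinomial_spec Finset.univ (k : Fin n → ℕ)
  rw [ballWeight_apply hq, Real.sq_sqrt (by positivity), Finsupp.degree_eq_sum, ← h]
  have h1 : (∏ i, ((k i).factorial : ℝ)) ≠ 0 :=
    Finset.prod_ne_zero_iff.2 fun i _ => by positivity
  have h2 : (Nat.multinomial Finset.univ (k : Fin n → ℕ) : ℝ) ≠ 0 := by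
    exact_mod_cast (Nat.multinomial_pos _ _).ne'
  push_cast
  field_simp

/-- The squared weight is the reciprocal of the multinomial coefficient, so the squared inequality
bounds a single term of the multinomial expansion of (∑ |z_i|²)^|k|. -/
theorem ball_dominates (hq : ‖(q : ℂ)‖ = 1) {ρ : ℝ} (hρ : 0 ≤ ρ) {z : Fin n → ℂ}
    (hz : ∑ i, ‖z i‖ ^ 2 ≤ ρ ^ 2) : (ballWeight q n).Dominates ρ z := by
  intro k
  have hk := (ballWeight q n).pos k
  refine le_of_pow_le_pow_left₀ two_ne_zero (by positivity) ?_
  have h1 : (Nat.multinomial Finset.univ (k : Fin n → ℕ) : ℝ) * ∏ i, (‖z i‖ ^ 2) ^ k i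
      ≤ (∑ i, ‖z i‖ ^ 2) ^ k.degree := by
    rw [Finset.sum_pow_eq_sum_piAntidiag]
    refine Finset.single_le_sum
      (f := fun k : Fin n → ℕ => (Nat.multinomial Finset.univ k : ℝ) * ∏ i, (‖z i‖ ^ 2) ^ k i)
      (fun l _ => by positivity) ?_
    simp [Finset.mem_piAntidiag, Finsupp.degree_eq_sum]
  have h2 := h1.trans (pow_le_pow_left₀ (Finset.sum_nonneg fun i _ => sq_nonneg _) hz _)
  have h3 := mul_le_mul_of_nonneg_left h2 (sq_nonneg ((ballWeight q n).toFun k))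
  rw [← mul_assoc, ballWeight_sq_mul_multinomial hq, one_mul] at h3
  calc ‖∏ i, z i ^ k i‖ ^ 2 = ∏ i, (‖z i‖ ^ 2) ^ k i := by
        rw [norm_prod, ← Finset.prod_pow]
        exact Finset.prod_congr rfl fun i _ => by rw [norm_pow]; ring
    _ ≤ _ := h3
    _ = _ := by ring

/-- A crude count suffices, since `le_of_pow_le_mul_pow` tolerates polynomial factors. -/
theorem card_piAntidiag_le (n d : ℕ) :
    (Finset.piAntidiag (Finset.univ : Finset (Fin n)) d).card ≤ (d + 1) ^ n := by
  have : Finset.piAntidiag (Finset.univ : Finset (Fin n)) d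
      ⊆ Fintype.piFinset fun _ => Finset.range (d + 1) := by
    intro k hk
    rw [Finset.mem_piAntidiag] at hk
    rw [Fintype.mem_piFinset]
    intro i
    rw [Finset.mem_range, Nat.lt_succ_iff, ← hk.1]
    exact Finset.single_le_sum (fun _ _ => Nat.zero_le _) (Finset.mem_univ i)
  refine (Finset.card_le_card this).trans ?_
  simp

/-- In the multinomial expansion of (∑ |χ(x_i)|²)^d the weights cancel the multinomial coefficients.
Each term is at most C²ρ^(2d), and the number of terms is polynomial in d. -/
theorem sum_sq_char_ball_lt {r : ℝ} (hq : (q : ℂ) = 1) (hr : 0 < r)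
    (χ : (ballWeight q n).algebra r →ₐ[ℂ] ℂ) (hχ : Continuous χ) :
    ∑ i, ‖χ ((ballWeight q n).gen r i)‖ ^ 2 < r ^ 2 := by
  obtain ⟨ρ, C, hC, h⟩ := Weight.exists_norm_char_le hq hr χ hχ
  refine lt_of_le_of_lt ?_ (pow_lt_pow_left₀ ρ.2.2 ρ.2.1.le two_ne_zero)
  refine le_of_pow_le_mul_pow (C := C ^ 2) n (sq_nonneg _) fun d => ?_
  rw [Finset.sum_pow_eq_sum_piAntidiag]
  have hterm : ∀ k ∈ Finset.piAntidiag (Finset.univ : Finset (Fin n)) d,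
      (Nat.multinomial Finset.univ k : ℝ)
        * ∏ i, (‖χ ((ballWeight q n).gen r i)‖ ^ 2) ^ k i ≤ C ^ 2 * ((ρ : ℝ) ^ 2) ^ d := by
    intro k hk
    rw [Finset.mem_piAntidiag] at hk
    set K : Fin n →₀ ℕ := Finsupp.equivFunOnFinite.symm k
    have hKk : (K : Fin n → ℕ) = k := rfl
    have hK : K.degree = d := by rw [Finsupp.degree_eq_sum]; exact hk.1
    have h1 := pow_le_pow_left₀ (norm_nonneg _) (h K) 2
    have h2 := ballWeight_sq_mul_multinomial (norm_one_of_eq_one hq) K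
    rw [hK, norm_prod, ← Finset.prod_pow, hKk] at h1
    rw [hKk] at h2
    have h3 := mul_le_mul_of_nonneg_left h1 (Nat.cast_nonneg' (Nat.multinomial Finset.univ k))
    calc _ = _ := by
          congr 1
          exact Finset.prod_congr rfl fun i _ => by rw [norm_pow, ← pow_mul, ← pow_mul, mul_comm]
      _ ≤ _ := h3
      _ = C ^ 2 * ((ρ : ℝ) ^ 2) ^ d
          * ((ballWeight q n).toFun K ^ 2 * (Nat.multinomial Finset.univ k : ℝ)) := by ring
      _ = _ := by rw [h2, mul_one]
  refine (Finset.sum_le_card_nsmul _ _ _ hterm).trans ?_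
  rw [nsmul_eq_mul]
  have hcard : ((Finset.piAntidiag (Finset.univ : Finset (Fin n)) d).card : ℝ)
      ≤ ((d : ℝ) + 1) ^ n := by exact_mod_cast card_piAntidiag_le n d
  have hnn : 0 ≤ C ^ 2 * ((ρ : ℝ) ^ 2) ^ d := by positivity
  calc _ ≤ ((d : ℝ) + 1) ^ n * (C ^ 2 * ((ρ : ℝ) ^ 2) ^ d) :=
        mul_le_mul_of_nonneg_right hcard hnn
    _ = _ := by ring

/-! ### Analytic discs in the polydisk and in the ball -/

theorem isDisc_mobius {r : ℝ} (hq : ‖(q : ℂ)‖ = 1) (hr : 0 < r) {p z : Fin n → ℂ}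
    (hp : ∀ i, ‖p i‖ < r) (hz : ∀ i, ‖z i‖ ≤ 1) :
    (polydiskWeight q n).IsDisc r r (fun ζ i => mobius r (p i) (ζ * z i)) where
  radius_pos := hr
  differentiableOn i ζ hζ := by
    have hζ' : ‖ζ * z i‖ < r := by
      rw [norm_mul]
      exact (mul_le_of_le_one_right (norm_nonneg _) (hz i)).trans_lt (by simpa using hζ)
    exact ((hasDerivAt_mobius (hp i) hζ').differentiableAt.comp ζ
      (differentiableAt_id.mul_const (z i))).differentiableWithinAt
  dominates s hs := by
    -- The maximum over the compact disc of radius s is attained and is below r; taking the larger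
    -- of it and s keeps the radius positive.
    have hb : ∀ i, ∃ ρ : Set.Ioo (0 : ℝ) r, ∀ σ : ℂ, ‖σ‖ ≤ s → ‖mobius r (p i) σ‖ ≤ ρ := by
      intro i
      have hlt : ∀ σ ∈ closedBall (0 : ℂ) s, ‖σ‖ < r := fun σ hσ =>
        (mem_closedBall_zero_iff.1 hσ).trans_lt hs.2
      have hcont : ContinuousOn (fun σ => ‖mobius r (p i) σ‖) (closedBall 0 s) := fun σ hσ =>
        (hasDerivAt_mobius (hp i) (hlt σ hσ)).continuousAt.norm.continuousWithinAt
      obtain ⟨σ₀, hσ₀, hmax⟩ := (isCompact_closedBall (0 : ℂ) s).exists_isMaxOn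
        ⟨0, mem_closedBall_self hs.1.le⟩ hcont
      have h0 := norm_mobius_lt hr (hp i) (hlt σ₀ hσ₀)
      refine ⟨⟨max ‖mobius r (p i) σ₀‖ s, lt_max_of_lt_right hs.1, max_lt h0 hs.2⟩, ?_⟩
      intro σ hσ
      exact (hmax (mem_closedBall_zero_iff.2 hσ)).trans (le_max_left _ _)
    choose ρ hρ using hb
    have : Nonempty (Set.Ioo (0 : ℝ) r) := ⟨⟨s, hs.1, hs.2⟩⟩
    obtain ⟨ρ', hρ'⟩ := Finite.exists_le ρ
    refine ⟨ρ', fun ζ hζ => polydisk_dominates hq fun i => (hρ i _ ?_).trans (hρ' i)⟩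
    rw [norm_mul]
    exact (mul_le_of_le_one_right (norm_nonneg _) (hz i)).trans hζ

/-- R may exceed r when u is shorter than 1; this gain contradicts the polydisk estimate later. -/
theorem isDisc_linear {r R : ℝ} (hq : ‖(q : ℂ)‖ = 1) (hr : 0 < r) (hR : 0 < R)
    (u : EuclideanSpace ℂ (Fin n)) (hu : R * ‖u‖ ≤ r) :
    (ballWeight q n).IsDisc r R (fun ζ i => ζ * u i) where
  radius_pos := hR
  differentiableOn i := by fun_prop
  dominates s hs := by
    have hρ : s * (r / R) ∈ Set.Ioo 0 r := by
      refine ⟨mul_pos hs.1 (by positivity), ?_⟩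
      rw [mul_div_assoc', div_lt_iff₀ hR, mul_comm r]
      exact mul_lt_mul_of_pos_right hs.2 hr
    refine ⟨⟨_, hρ⟩, fun ζ hζ => ball_dominates hq hρ.1.le ?_⟩
    simp only [norm_mul, mul_pow, ← Finset.mul_sum, ← EuclideanSpace.norm_sq_eq]
    rw [← mul_pow]
    have hu' : ‖u‖ ≤ r / R := by rw [le_div_iff₀ hR]; linarith
    rw [← mul_pow]
    exact pow_le_pow_left₀ (by positivity)
      (mul_le_mul hζ hu' (norm_nonneg _) hs.1.le) 2

/-! ### The commutative case -/

/-- E is the derivative along ζ ↦ ζu, since both agree on generators. Along this disc the i-th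
coordinate of φ is a holomorphic map from radius R to radius r, so Schwarz–Pick applies. -/
theorem norm_derivation_map_gen_le {r R : ℝ} (hq : (q : ℂ) = 1) (hr : 0 < r) (hR : 0 < R)
    (φ : (polydiskWeight q n).algebra r →ₐ[ℂ] (ballWeight q n).algebra r) (hφ : Continuous φ)
    {E : (ballWeight q n).algebra r →ₗ[ℂ] ℂ} (hEc : Continuous E)
    (hE : (ballWeight q n).IsPointDerivation ((ballWeight q n).aug r) E)
    (u : EuclideanSpace ℂ (Fin n)) (hu : ∀ j, E ((ballWeight q n).gen r j) = u j)
    (huR : R * ‖u‖ ≤ r) (i : Fin n) :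
    ‖E (φ ((polydiskWeight q n).gen r i))‖
      ≤ (r ^ 2 - ‖(ballWeight q n).aug r (φ ((polydiskWeight q n).gen r i))‖ ^ 2) / r ^ 2
        * (r / R) := by
  have hdisc := isDisc_linear (norm_one_of_eq_one hq) hr hR u huR
  have h0 : ∀ a : (ballWeight q n).algebra r, (ballWeight q n).aug r a
      = Weight.evalFun (fun i => (0 : ℂ) * u i) (a : QSeries q n) := by
    intro a
    have : (fun i => (0 : ℂ) * u i) = 0 := by ext; simp
    rw [this, Weight.evalFun_zero, Weight.aug_apply]
  have hEq : E = hdisc.derivation hq :=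
    hE.ext (hdisc.isPointDerivation hq _ h0) hEc (hdisc.continuous_derivation hq) fun j => by
      rw [hu, hdisc.derivation_gen]
      simp
  rw [hEq, hdisc.derivation_apply, h0]
  refine norm_deriv_le_of_mapsTo_disc hr hR
    (hdisc.differentiableOn_evalFun (φ ((polydiskWeight q n).gen r i))) fun ζ hζ => ?_
  obtain ⟨ρ, hρ⟩ := hdisc.exists_dominates hζ
  exact norm_char_polydisk_lt hq hr ((hρ.eval hq).comp φ) ((hρ.continuous_eval hq).comp hφ) i

/-- For every tangent vector `z` of the polydisk with `|z_i| ≤ 1`, the derivative along the disc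
through `p` with direction `z` is transported to a point derivation of the ball at `0` given by a
vector of norm at most `1`. -/
theorem exists_derivation {r : ℝ} (hq : (q : ℂ) = 1) (hr : 0 < r)
    (φ : (polydiskWeight q n).algebra r →ₐ[ℂ] (ballWeight q n).algebra r)
    (ψ : (ballWeight q n).algebra r →ₐ[ℂ] (polydiskWeight q n).algebra r)
    (hφ : Continuous φ) (hψ : Continuous ψ)
    (hψφ : ∀ a, ψ (φ a) = a) (hφψ : ∀ b, φ (ψ b) = b) (z : Fin n → ℂ) (hz : ∀ i, ‖z i‖ ≤ 1) :
    ∃ E : (ballWeight q n).algebra r →ₗ[ℂ] ℂ, Continuous E ∧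
      (ballWeight q n).IsPointDerivation ((ballWeight q n).aug r) E ∧
      (∀ i, E (φ ((polydiskWeight q n).gen r i)) =
        (((r ^ 2 - ‖(ballWeight q n).aug r (φ ((polydiskWeight q n).gen r i))‖ ^ 2) / r ^ 2 : ℝ) : ℂ)
          * z i) ∧
      ∃ w : EuclideanSpace ℂ (Fin n), ‖w‖ ≤ 1 ∧ ∀ j, E ((ballWeight q n).gen r j) = w j := by
  have hq1 := norm_one_of_eq_one hq
  set p : Fin n → ℂ := fun i => (ballWeight q n).aug r (φ ((polydiskWeight q n).gen r i)) with hpdef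
  have hp : ∀ i, ‖p i‖ < r := norm_char_polydisk_lt hq hr (((ballWeight q n).aug r).comp φ)
    (((ballWeight q n).continuous_aug hr).comp hφ)
  have hdisc := isDisc_mobius hq1 hr hp hz
  have hγ0 : (fun i => mobius r (p i) (0 * z i)) = p := by
    ext i; rw [zero_mul, mobius_zero hr]
  obtain ⟨ρ₀, hρ₀⟩ := hdisc.exists_dominates (ζ := 0) (by simpa using hr)
  rw [hγ0] at hρ₀
  have hχ : ((ballWeight q n).aug r).comp φ = hρ₀.eval hq :=
    (polydiskWeight q n).char_ext _ _ (((ballWeight q n).continuous_aug hr).comp hφ)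
      (hρ₀.continuous_eval hq) fun i => by
        rw [hρ₀.eval_apply, Weight.evalFun_gen]
        rfl
  have hχ' : (hρ₀.eval hq).comp ψ = (ballWeight q n).aug r := by
    rw [← hχ]; ext b; simp [hφψ]
  have hD : (polydiskWeight q n).IsPointDerivation (hρ₀.eval hq) (hdisc.derivation hq) :=
    hdisc.isPointDerivation hq _ fun a => by rw [hγ0, hρ₀.eval_apply]
  have hE := hD.comp ψ
  rw [hχ'] at hE
  have hr' : (r : ℂ) ≠ 0 := by exact_mod_cast hr.ne'
  refine ⟨(hdisc.derivation hq).comp ψ.toLinearMap, (hdisc.continuous_derivation hq).comp hψ, hE,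
    fun i => ?_, ?_⟩
  · have h1 : HasDerivAt (fun ζ : ℂ => ζ * z i) (1 * z i) 0 := (hasDerivAt_id 0).mul_const _
    have h2 := hasDerivAt_mobius (r := r) (p := p i) (s := 0 * z i) (hp i) (by simpa using hr)
    have h3 := (h2.comp 0 h1).deriv
    rw [LinearMap.comp_apply, AlgHom.toLinearMap_apply, hψφ, hdisc.derivation_gen]
    refine h3.trans ?_
    rw [conj_mul_self_eq]
    push_cast
    field_simp
    simp only [mul_zero, zero_mul, add_zero, hpdef]
    ring
  -- H is the image of the Möbius disc in the ball. It maps 0 to 0, so the vector-valued Schwarz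
  -- lemma bounds its derivative by 1.
  · set H : ℂ → EuclideanSpace ℂ (Fin n) := fun ζ => WithLp.toLp 2 fun j =>
      Weight.evalFun (fun i => mobius r (p i) (ζ * z i))
        ((ψ ((ballWeight q n).gen r j) : (polydiskWeight q n).algebra r) : QSeries q n) with hH
    have hHd : DifferentiableOn ℂ H (ball 0 r) := by
      rw [differentiableOn_euclidean]
      exact fun j => hdisc.differentiableOn_evalFun (ψ ((ballWeight q n).gen r j))
    have hH0 : H 0 = 0 := by
      ext j
      have := AlgHom.congr_fun hχ' ((ballWeight q n).gen r j)
      rw [Weight.aug_gen, AlgHom.comp_apply, hρ₀.eval_apply, ← hγ0] at this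
      exact this
    have hHmaps : Set.MapsTo H (ball 0 r) (closedBall (H 0) r) := by
      intro ζ hζ
      rw [hH0, mem_closedBall_zero_iff]
      obtain ⟨ρ, hρ⟩ := hdisc.exists_dominates (mem_ball_zero_iff.1 hζ)
      have := sum_sq_char_ball_lt hq hr ((hρ.eval hq).comp ψ) ((hρ.continuous_eval hq).comp hψ)
      refine le_of_pow_le_pow_left₀ two_ne_zero hr.le ?_
      rw [EuclideanSpace.norm_sq_eq]
      exact this.le
    refine ⟨deriv H 0, Complex.norm_deriv_le_one_of_mapsTo_ball hHd hHmaps hr, fun j => ?_⟩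
    have hHat := (hHd.differentiableAt (ball_mem_nhds 0 hr)).hasDerivAt
    exact ((EuclideanSpace.proj (𝕜 := ℂ) j).hasFDerivAt.comp_hasDerivAt 0 hHat).deriv

/-- The directions e₀ + e₁ and e₀ - e₁ are unit vectors for the sup norm, and so are their half-sum
and half-difference. Their images w, w' have norm at most 1, so by the parallelogram law (w + w')/2
or (w - w')/2 has squared norm at most 1/2, too short for a sup-norm unit vector. -/
theorem not_iso_of_eq_one {r : ℝ} (hq : (q : ℂ) = 1) (hn : 2 ≤ n) (hr : 0 < r)
    (φ : (polydiskWeight q n).algebra r →ₐ[ℂ] (ballWeight q n).algebra r)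
    (ψ : (ballWeight q n).algebra r →ₐ[ℂ] (polydiskWeight q n).algebra r)
    (hφ : Continuous φ) (hψ : Continuous ψ)
    (hψφ : ∀ a, ψ (φ a) = a) (hφψ : ∀ b, φ (ψ b) = b) : False := by
  let i₀ : Fin n := ⟨0, by omega⟩
  let i₁ : Fin n := ⟨1, by omega⟩
  have h01 : i₀ ≠ i₁ := by simp [i₀, i₁]
  have hp : ∀ i, ‖(ballWeight q n).aug r (φ ((polydiskWeight q n).gen r i))‖ < r :=
    norm_char_polydisk_lt hq hr (((ballWeight q n).aug r).comp φ)
      (((ballWeight q n).continuous_aug hr).comp hφ)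
  have key : ∀ (E : (ballWeight q n).algebra r →ₗ[ℂ] ℂ), Continuous E →
      (ballWeight q n).IsPointDerivation ((ballWeight q n).aug r) E →
      ∀ u : EuclideanSpace ℂ (Fin n), (∀ j, E ((ballWeight q n).gen r j) = u j) →
      ‖u‖ ^ 2 ≤ 1 / 2 → ∀ i, E (φ ((polydiskWeight q n).gen r i)) ≠
        (((r ^ 2 - ‖(ballWeight q n).aug r (φ ((polydiskWeight q n).gen r i))‖ ^ 2) / r ^ 2 : ℝ) : ℂ) := by
    intro E hEc hE u hu hu2 i hEi
    have hs : (0 : ℝ) < √2 := by positivity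
    have hs1 : 1 < √2 := Real.lt_sqrt_of_sq_lt (by norm_num)
    -- The short vector admits a disc of radius r√2, so Schwarz–Pick gains a factor 1/√2 over the
    -- value assumed in `hEi`.
    have huR : r * √2 * ‖u‖ ≤ r := by
      rw [mul_assoc]
      refine mul_le_of_le_one_right hr.le ?_
      refine le_of_pow_le_pow_left₀ two_ne_zero zero_le_one ?_
      rw [mul_pow, Real.sq_sqrt (by norm_num)]
      linarith
    have h := norm_derivation_map_gen_le hq hr (mul_pos hr hs) φ hφ hEc hE u hu huR i
    have hδ : 0 < (r ^ 2 - ‖(ballWeight q n).aug r (φ ((polydiskWeight q n).gen r i))‖ ^ 2) / r ^ 2 :=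
      div_pos (sub_pos.2 (pow_lt_pow_left₀ (hp i) (norm_nonneg _) two_ne_zero)) (by positivity)
    rw [hEi, Complex.norm_real, Real.norm_of_nonneg hδ.le] at h
    have h1 : r / (r * √2) < 1 := by
      rw [div_lt_one (by positivity)]
      exact lt_mul_of_one_lt_right hr hs1
    exact absurd h (not_le.2 (mul_lt_of_lt_one_right hδ h1))
  have hsingle : ∀ ε : ℂ, ‖ε‖ ≤ 1 → ∀ i, ‖(Pi.single i₀ 1 + Pi.single i₁ ε : Fin n → ℂ) i‖ ≤ 1 := by
    intro ε hε i
    by_cases h0 : i = i₀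
    · subst h0; simp [h01]
    · by_cases h1 : i = i₁
      · subst h1; simp [h0, hε]
      · simp [h0, h1]
  obtain ⟨E, hEc, hE, hEφ, w, hw, hEw⟩ := exists_derivation hq hr φ ψ hφ hψ hψφ hφψ
    (Pi.single i₀ 1 + Pi.single i₁ 1) (hsingle 1 (by simp))
  obtain ⟨E', hEc', hE', hEφ', w', hw', hEw'⟩ := exists_derivation hq hr φ ψ hφ hψ hψφ hφψ
    (Pi.single i₀ 1 + Pi.single i₁ (-1)) (hsingle (-1) (by simp))
  have hpar := parallelogram_law_with_norm ℂ w w'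
  have hsq : ‖w‖ * ‖w‖ ≤ 1 := by nlinarith [norm_nonneg w]
  have hsq' : ‖w'‖ * ‖w'‖ ≤ 1 := by nlinarith [norm_nonneg w']
  rcases le_or_gt (‖w + w'‖ ^ 2) 2 with h | h
  · refine key ((1 / 2 : ℂ) • (E + E')) ((hEc.add hEc').const_smul (1 / 2 : ℂ))
      ((hE.add hE').smul _) ((1 / 2 : ℂ) • (w + w')) (fun j => by simp [hEw, hEw']) ?_ i₀ ?_
    · rw [norm_smul, mul_pow]
      norm_num
      linarith
    · simp only [LinearMap.smul_apply, LinearMap.add_apply, hEφ, hEφ', Pi.add_apply,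
        Pi.single_eq_same, Pi.single_eq_of_ne h01, smul_eq_mul]
      ring
  · refine key ((1 / 2 : ℂ) • (E + (-1 : ℂ) • E'))
      ((hEc.add (hEc'.const_smul (-1 : ℂ))).const_smul (1 / 2 : ℂ))
      ((hE.add (hE'.smul _)).smul _) ((1 / 2 : ℂ) • (w - w'))
      (fun j => by simp [hEw, hEw', sub_eq_add_neg]) ?_ i₁ ?_
    · rw [norm_smul, mul_pow]
      norm_num
      nlinarith
    · simp only [LinearMap.smul_apply, LinearMap.add_apply, hEφ, hEφ', Pi.add_apply,
        Pi.single_eq_same, Pi.single_eq_of_ne h01.symm, smul_eq_mul]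
      ring

end QuantumHolomorphic

end

theorem theorem4p14 (q : ℂˣ) (hq : ‖(q : ℂ)‖ = 1) (n : ℕ) (hn : 2 ≤ n) (r : ℝ) (hr : 0 < r) :
    IsEmpty (QuantumHolomorphic.QuantumPolydisk q n r ≃A[ℂ]
      QuantumHolomorphic.QuantumBall q n r) := by
  refine ⟨fun e => ?_⟩
  by_cases hq1 : (q : ℂ) = 1
  · exact QuantumHolomorphic.not_iso_of_eq_one hq1 hn hr
      e.toAlgEquiv.toAlgHom e.symm.toAlgEquiv.toAlgHom e.continuous e.symm.continuous
      e.symm_apply_apply e.apply_symm_apply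
  · exact QuantumHolomorphic.Weight.not_iso_of_ne_one hq hq1 hn hr
      (QuantumHolomorphic.polydiskWeight_apply hq) (QuantumHolomorphic.ballWeight_single hq)
      (fun i j hij m => QuantumHolomorphic.ballWeight_pair_le hq hij m)
      e.toAlgEquiv.toAlgHom e.symm.toAlgEquiv.toAlgHom e.continuous e.symm.continuous
      e.symm_apply_apply e.apply_symm_apply
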